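/- Consider $m\ge 1$ identical items whose horizons $H_1,\dots,H_m$ are i.i.d. geometric with some departure rate $\lambda\in(0,1]$, i.e. $\Pr[H_i=h]=(1-\lambda)^{h-1}\lambda$ for $h=1,2,\dots$, and an infinite stream of unit-demand buyers whose valuations $X_1,X_2,\dots\ge 0$ are i.i.d. from a distribution $V$ with finite mean, independent of the horizons. Item $i$ is present for buyers $1,\dots,H_i$, and a buyer $h$ who is matched to an item that is present contributes $X_h$ to the welfare. The prophet knows all horizons and valuations and obtains the maximum welfare of a matching of items to buyers; let $\mathrm{Pro}_m(\lambda,V)$ be its expectation. A dynamic pricing scheme for $m$ items knows $\lambda$ and $V$. Before each buyer arrives it posts a price, which may depend on private randomness, on the valuations of the earlier buyers and on the departures that have occurred so far, but not on the horizons of items still present or on current or future valuations. The buyer takes an available item if some item is present and unsold and her valuation is at least the price. A fixed pricing scheme posts one and the same price (possibly drawn at random once, and possibly depending on $\lambda$ and $V$) to all buyers. The competitive ratio of a scheme for $m$ items is the least $c\in[0,\infty]$ such that, for all $\lambda$ and $V$, $\mathrm{Pro}_m(\lambda,V)$ is at most $c$ times the expected welfare of the scheme. Then: 1. For every $m\ge1$,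 every dynamic pricing scheme for $m$ items has competitive ratio at least $\pi/2\approx 1.57$. In the limit $m\to\infty$ this lower bound improves to $2$: for every $c<2$ there is $M$ such that, for all $m\ge M$, every dynamic pricing scheme for $m$ items has competitive ratio at least $c$. 2. There are a constant $c>0$ and an $M$ such that, for all $m\ge M$, every fixed pricing scheme for $m$ items has competitive ratio at least $c\log\log m$. In particular, no fixed pricing scheme is $o(\log\log m)$-competitive. -/

import Mathlib

open MeasureTheory ProbabilityTheory
open scoped NNReal ENNReal

noncomputable section

namespace Prophet

/-- An instance with i.i.d. geometric horizons and i.i.d. buyer valuations: each item departs after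
each time step with probability `rate`, and the valuations have law `valuation`, a probability
measure on `[0, ∞)` with finite mean. -/
structure GeometricInstance where
  rate : unitInterval
  rate_ne_zero : rate ≠ 0
  valuation : Measure ℝ≥0
  valuation_prob : IsProbabilityMeasure valuation
  finite_mean : ∫⁻ x, (x : ℝ≥0∞) ∂valuation ≠ ∞

attribute [instance] GeometricInstance.valuation_prob

/-- The geometric horizon law on `{1, 2, 3, …}`: the value `h` has probability
`(1 - rate) ^ (h - 1) * rate`, so that the mean is `1 / rate`. -/
def GeometricInstance.horizon (I : GeometricInstance) : Measure ℕ :=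
  (geometricMeasure I.rate).map (fun n => n + 1)

/-- The joint law of the horizons of `m` items and of the infinite stream of valuations. All of
these random variables are independent. -/
def GeometricInstance.law (I : GeometricInstance) (m : ℕ) :
    Measure ((Fin m → ℕ) × (ℕ → ℝ≥0)) :=
  (Measure.pi fun _ : Fin m => I.horizon).prod (Measure.infinitePi fun _ : ℕ => I.valuation)

/-- Buyers are numbered `0, 1, 2, …`. Item `i` is present for the first `H i` buyers, that is, for
buyer `t` if and only if `t < H i`. A matching `M` sends each item to at most one buyer (`none`
means that the item is not matched), no two items to the same buyer, and each matched item to a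
buyer for whom it is present. -/
def IsMatching {m : ℕ} (H : Fin m → ℕ) (M : Fin m → Option ℕ) : Prop :=
  (∀ i j t, M i = some t → M j = some t → i = j) ∧ ∀ i t, M i = some t → t < H i

/-- The welfare of a matching when buyer `t` has valuation `X t`. -/
def matchingWelfare {m : ℕ} (X : ℕ → ℝ≥0) (M : Fin m → Option ℕ) : ℝ≥0∞ :=
  ∑ i, (M i).elim 0 fun t => (X t : ℝ≥0∞)

/-- The welfare of the prophet, who knows all horizons and valuations. -/
def prophetWelfare {m : ℕ} (H : Fin m → ℕ) (X : ℕ → ℝ≥0) : ℝ≥0∞ :=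
  ⨆ (M : Fin m → Option ℕ) (_ : IsMatching H M), matchingWelfare X M

/-- The expected welfare of the prophet with `m` items. -/
def GeometricInstance.prophet (I : GeometricInstance) (m : ℕ) : ℝ≥0∞ :=
  ∫⁻ ω, prophetWelfare ω.1 ω.2 ∂I.law m

/-- A (possibly randomized) online dynamic pricing policy for `m` items. Before buyer `t` arrives,
it has access to a private random seed, to the valuations of the earlier buyers, for each item `i`
to the number `min (H i) (t + 1)` (the horizon of the item if it has already departed, and `t + 1`
if it is still present), and to the set `A` of the items that are present and unsold. It posts a
price, where the price `∞` rejects every buyer. If a sale takes place, the policy also selects which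
of the items in `A` is sold. -/
structure PricingPolicy (m : ℕ) where
  Seed : Type
  [seedSpace : MeasurableSpace Seed]
  seedLaw : Measure Seed
  seedLaw_prob : IsProbabilityMeasure seedLaw
  price (t : ℕ) (r : Seed) (past : Fin t → ℝ≥0) (obs : Fin m → ℕ) (A : Finset (Fin m)) : ℝ≥0∞
  measurable_price : ∀ t A, Measurable
    fun x : Seed × (Fin t → ℝ≥0) × (Fin m → ℕ) => price t x.1 x.2.1 x.2.2 A
  select (t : ℕ) (r : Seed) (past : Fin t → ℝ≥0) (obs : Fin m → ℕ) (A : Finset (Fin m))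
    (hA : A.Nonempty) : Fin m
  select_mem : ∀ t r past obs A hA, select t r past obs A hA ∈ A
  measurable_select : ∀ t A hA, Measurable
    fun x : Seed × (Fin t → ℝ≥0) × (Fin m → ℕ) => select t x.1 x.2.1 x.2.2 A hA

attribute [instance] PricingPolicy.seedSpace PricingPolicy.seedLaw_prob

namespace PricingPolicy

variable {m : ℕ} (P : PricingPolicy m)

/-- The item sold to buyer `t`, if any, when `U` is the set of items not sold to earlier buyers:
a sale takes place if and only if some unsold item is still present and the valuation of the buyer
is at least the posted price. -/
def sale (r : P.Seed) (H : Fin m → ℕ) (X : ℕ → ℝ≥0) (t : ℕ) (U : Finset (Fin m)) :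
    Option (Fin m) :=
  let A := U.filter fun i => t < H i
  let past : Fin t → ℝ≥0 := fun s => X s
  let obs : Fin m → ℕ := fun i => min (H i) (t + 1)
  open scoped Classical in
  if h : A.Nonempty ∧ P.price t r past obs A ≤ X t then some (P.select t r past obs A h.1) else none

/-- The items that have not been sold to any of the buyers `0, …, t - 1`. -/
def unsold (r : P.Seed) (H : Fin m → ℕ) (X : ℕ → ℝ≥0) : ℕ → Finset (Fin m)
  | 0 => Finset.univ
  | t + 1 => (unsold r H X t).filter fun i => P.sale r H X t (unsold r H X t) ≠ some i

/-- The welfare of the policy: the sum of the valuations of the buyers who buy an item. -/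
def welfare (r : P.Seed) (H : Fin m → ℕ) (X : ℕ → ℝ≥0) : ℝ≥0∞ :=
  ∑' t, if (P.sale r H X t (P.unsold r H X t)).isSome then (X t : ℝ≥0∞) else 0

/-- The expected welfare of the policy. The seed is independent of the horizons and valuations. -/
def value (I : GeometricInstance) : ℝ≥0∞ :=
  ∫⁻ ω, P.welfare ω.1 ω.2.1 ω.2.2 ∂P.seedLaw.prod (I.law m)

/-- A fixed-price policy posts one and the same price to all buyers. This price may be drawn at
random at the start, but it depends neither on the time nor on the history. -/
def IsFixedPrice : Prop :=
  ∃ p : P.Seed → ℝ≥0∞, ∀ t r past obs A, P.price t r past obs A = p r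

end PricingPolicy

/-- A dynamic pricing scheme for `m` items knows the horizon law and the valuation law, so it may
use a different policy on each instance. -/
def PricingScheme (m : ℕ) : Type 1 := GeometricInstance → PricingPolicy m

namespace PricingScheme

variable {m : ℕ}

/-- The competitive ratio of a scheme on the instances with `m` items and i.i.d. geometric horizons:
the least `c` such that the prophet gets at most `c` times what the scheme gets. -/
def competitiveRatio (S : PricingScheme m) : ℝ≥0∞ :=
  sInf {c : ℝ≥0∞ | ∀ I : GeometricInstance, I.prophet m ≤ c * (S I).value I}

/-- A fixed pricing scheme uses a fixed-price policy on each instance. -/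
def IsFixedPrice (S : PricingScheme m) : Prop := ∀ I, (S I).IsFixedPrice

end PricingScheme

end Prophet

end

/-!
All three bounds compare an upper bound on what any policy earns with a lower bound on what the
prophet earns, on explicit instances with a small departure rate `l`.

**Policies.** `PricingPolicy.lintegral_welfare_le` is a potential argument. With `k` items present
and unsold, the future is worth at most `δ 0 + ⋯ + δ (k - 1)`, provided that the potential lost in
one step (each of the `k` items departs with probability `l`, and a sold item is lost if it would
have stayed) pays for the expected welfare of a sale at every price the policy may post. Since
horizons are memoryless and valuations are independent, the law of the instance does not change when
the valuation of buyer `t` and the departures after her arrival are drawn afresh, which is how the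
expectation of one step is computed.

**Prophet, few items.** `GeometricInstance.prophet_succ_ge` gives the prophet the best buyer between
any two consecutive departures, by induction on the number of items.

**Prophet, many items.** `prophet_ge_sum_blocks` cuts the buyers into blocks, and serves the buyers
above a threshold in one block by the items that depart in the next block. By Chebyshev's
inequality there are enough such items as soon as this holds in expectation with some room.

**Dynamic prices.** For valuations with tail `x ^ (-2)`, the potential `δ (k - 1) = 1 / √(l k)`
works up to lower order terms, so that a policy earns at most `∑ 1 / √(l k)`. The best of the
buyers seen while exactly `k` items are present is worth `(π / 2) / √(l k)`, which gives the
ratio `π / 2` for every number of items. For `m → ∞` the block bound yields `4 √(m / l)`, twice the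
`2 √(m / l)` of the policy.

**Fixed prices.** The valuation has infinitely many scales: it lies on scale `j` or higher with
probability `2 ^ (-j)`, and these scales contribute `1 / (j + 3)` to its mean. When half of the
items survive `m` buyers, a price that accepts the scales from `j` on sells everything within
`O(m (j + 1))` buyers, and thus earns `O(m)`. The prophet can use one scale for each of the roughly
`log m` blocks of `m` buyers, and earns `m ∑ 1 / (j + 6)` up to a constant, which is of order
`m log (log m)`.
-/

namespace Prophet

/-! ### Memoryless horizons and resampling -/

namespace GeometricInstance

variable (I : GeometricInstance)

/-- The departure rate as an extended nonnegative real. -/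
noncomputable def dep : ℝ≥0∞ := ENNReal.ofReal I.rate

/-- The probability to stay for one more buyer. -/
noncomputable def surv : ℝ≥0∞ := ENNReal.ofReal (1 - I.rate)

lemma dep_add_surv : I.dep + I.surv = 1 := by
  have h := I.rate.2
  rw [dep, surv, ← ENNReal.ofReal_add h.1 (by linarith [h.2])]
  simp

lemma surv_ne_top : I.surv ≠ ∞ := ENNReal.ofReal_ne_top

lemma geometric_singleton (n : ℕ) : geometricMeasure I.rate {n} = I.surv ^ n * I.dep := by
  have h := I.rate.2
  rw [geometricMeasure_singleton I.rate_ne_zero, ENNReal.ofReal_mul (by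
    have := h.2; exact pow_nonneg (by linarith) _), ENNReal.ofReal_pow (by linarith [h.2])]
  rfl

lemma horizon_singleton_zero : I.horizon {0} = 0 := by
  rw [horizon, Measure.map_apply (by fun_prop) (measurableSet_singleton _)]
  convert measure_empty (μ := geometricMeasure I.rate)
  ext n; simp

lemma horizon_singleton_succ (n : ℕ) : I.horizon {n + 1} = I.surv ^ n * I.dep := by
  rw [horizon, Measure.map_apply (by fun_prop) (measurableSet_singleton _),
    ← geometric_singleton]
  congr 1
  ext k; simp

instance : IsProbabilityMeasure I.horizon :=
  Measure.isProbabilityMeasure_map (by fun_prop)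

instance (m : ℕ) : IsProbabilityMeasure (I.law m) := by
  unfold law; infer_instance

lemma horizon_Ioi (t : ℕ) : I.horizon (Set.Ioi t) = I.surv ^ t := by
  induction t with
  | zero =>
    have h : I.horizon (Set.Ioi 0)ᶜ = 0 := by
      convert I.horizon_singleton_zero
      ext n; simp
    simpa using (prob_compl_eq_zero_iff (measurableSet_Ioi)).1 h
  | succ t ih =>
    have h : Set.Ioi t = {t + 1} ∪ Set.Ioi (t + 1) := by
      ext n; simp
    rw [h, measure_union (by simp) measurableSet_Ioi, I.horizon_singleton_succ] at ih
    have h2 : I.surv ^ t = I.surv ^ t * I.dep + I.surv ^ (t + 1) := by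
      rw [pow_succ, ← mul_add, I.dep_add_surv, mul_one]
    have hf : I.surv ^ t * I.dep ≠ ∞ :=
      ENNReal.mul_ne_top (ENNReal.pow_ne_top I.surv_ne_top) ENNReal.ofReal_ne_top
    exact (ENNReal.add_right_inj hf).1 (ih.trans h2)

/-- The memoryless property: an item still present for buyer `t` may have the rest of its horizon
drawn afresh. -/
lemma measurePreserving_horizon_resample (t : ℕ) :
    MeasurePreserving (fun x : ℕ × ℕ => if x.1 ≤ t then x.1 else t + 1 + x.2)
      (I.horizon.prod (geometricMeasure I.rate)) I.horizon := by
  refine ⟨Measurable.of_discrete, Measure.ext_of_singleton fun k => ?_⟩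
  rw [Measure.map_apply Measurable.of_discrete (measurableSet_singleton _)]
  by_cases hk : k ≤ t
  · have : (fun x : ℕ × ℕ => if x.1 ≤ t then x.1 else t + 1 + x.2) ⁻¹' {k}
        = {k} ×ˢ Set.univ := by
      ext ⟨a, b⟩
      simp only [Set.mem_preimage, Set.mem_singleton_iff, Set.mem_prod, Set.mem_univ, and_true]
      split_ifs <;> omega
    rw [this, Measure.prod_prod, measure_univ, mul_one]
  · obtain ⟨n, rfl⟩ : ∃ n, k = t + 1 + n := ⟨k - (t + 1), by omega⟩
    have : (fun x : ℕ × ℕ => if x.1 ≤ t then x.1 else t + 1 + x.2) ⁻¹' {t + 1 + n}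
        = Set.Ioi t ×ˢ {n} := by
      ext ⟨a, b⟩
      simp only [Set.mem_preimage, Set.mem_singleton_iff, Set.mem_prod, Set.mem_Ioi]
      split_ifs <;> omega
    rw [this, Measure.prod_prod, I.horizon_Ioi, I.geometric_singleton,
      show t + 1 + n = (t + n) + 1 by ring, I.horizon_singleton_succ, pow_add, mul_assoc]

lemma measurePreserving_horizons_resample (m t : ℕ) :
    MeasurePreserving
      (fun (x : (Fin m → ℕ) × (Fin m → ℕ)) i => if x.1 i ≤ t then x.1 i else t + 1 + x.2 i)
      ((Measure.pi fun _ : Fin m => I.horizon).prod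
        (Measure.pi fun _ : Fin m => geometricMeasure I.rate))
      (Measure.pi fun _ : Fin m => I.horizon) := by
  have h1 := (measurePreserving_arrowProdEquivProdArrow ℕ ℕ (Fin m)
    (fun _ => I.horizon) (fun _ => geometricMeasure I.rate)).symm
  have h2 := measurePreserving_pi (fun _ : Fin m => I.horizon.prod (geometricMeasure I.rate))
    (fun _ : Fin m => I.horizon) (fun _ => I.measurePreserving_horizon_resample t)
  exact h2.comp h1

end GeometricInstance

/-- Replacing one coordinate of an i.i.d. sequence by a fresh copy preserves the law. -/
lemma measurePreserving_update (μ : Measure ℝ≥0) [IsProbabilityMeasure μ] (t : ℕ) :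
    MeasurePreserving (fun x : (ℕ → ℝ≥0) × ℝ≥0 => Function.update x.1 t x.2)
      ((Measure.infinitePi fun _ : ℕ => μ).prod μ) (Measure.infinitePi fun _ : ℕ => μ) := by
  have hm : Measurable (fun x : (ℕ → ℝ≥0) × ℝ≥0 => Function.update x.1 t x.2) := by
    refine measurable_pi_lambda _ fun i => ?_
    by_cases h : i = t
    · subst h; simpa using measurable_snd
    · simpa [h, Function.comp_def] using (measurable_pi_apply i).comp measurable_fst
  refine ⟨hm, Measure.eq_infinitePi (fun _ => μ) fun s T hT => ?_⟩
  rw [Measure.map_apply hm (MeasurableSet.pi s.countable_toSet fun i _ => hT i)]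
  by_cases ht : t ∈ s
  · have : (fun x : (ℕ → ℝ≥0) × ℝ≥0 => Function.update x.1 t x.2) ⁻¹' (Set.pi s T)
        = (Set.pi (s.erase t : Finset ℕ) T) ×ˢ T t := by
      ext ⟨x, y⟩
      simp only [Set.mem_preimage, Set.mem_pi, Set.mem_prod, Finset.mem_coe, Finset.mem_erase]
      constructor
      · intro h
        exact ⟨fun i hi => by simpa [hi.1] using h i hi.2, by simpa using h t ht⟩
      · rintro ⟨h, h'⟩ i hi
        by_cases hit : i = t
        · subst hit; simpa using h'
        · simpa [hit] using h i ⟨hit, hi⟩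
    rw [this, Measure.prod_prod, Measure.infinitePi_pi _ fun i _ => hT i,
      Finset.prod_erase_mul _ _ ht]
  · have : (fun x : (ℕ → ℝ≥0) × ℝ≥0 => Function.update x.1 t x.2) ⁻¹' (Set.pi s T)
        = (Set.pi s T) ×ˢ Set.univ := by
      ext ⟨x, y⟩
      simp only [Set.mem_preimage, Set.mem_pi, Set.mem_prod, Finset.mem_coe, Set.mem_univ, and_true]
      refine forall₂_congr fun i hi => ?_
      have : i ≠ t := fun h => ht (h ▸ hi)
      simp [this]
    rw [this, Measure.prod_prod, Measure.infinitePi_pi _ fun i _ => hT i, measure_univ, mul_one]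

lemma measurePreserving_prodProdProdComm {α β γ δ : Type*} [MeasurableSpace α] [MeasurableSpace β]
    [MeasurableSpace γ] [MeasurableSpace δ] (a : Measure α) (b : Measure β) (c : Measure γ)
    (d : Measure δ) [SFinite a] [SFinite b] [SFinite c] [SFinite d] :
    MeasurePreserving (fun x : (α × β) × γ × δ => ((x.1.1, x.2.1), (x.1.2, x.2.2)))
      ((a.prod b).prod (c.prod d)) ((a.prod c).prod (b.prod d)) := by
  have h1 := measurePreserving_prodAssoc a b (c.prod d)
  have h2 := (MeasurePreserving.id a).prod (measurePreserving_prodAssoc b c d).symm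
  have h3 := (MeasurePreserving.id a).prod
    ((Measure.measurePreserving_swap (μ := b) (ν := c)).prod (MeasurePreserving.id d))
  have h4 := (MeasurePreserving.id a).prod (measurePreserving_prodAssoc c b d)
  have h5 := (measurePreserving_prodAssoc a c (b.prod d)).symm
  exact h5.comp (h4.comp (h3.comp (h2.comp h1)))

/-- The law is preserved when the horizons beyond the arrival of buyer `t` and the valuation of
buyer `t` are drawn afresh. -/
lemma GeometricInstance.measurePreserving_resample (I : GeometricInstance) (m t : ℕ) :
    MeasurePreserving
      (fun x : ((Fin m → ℕ) × (ℕ → ℝ≥0)) × (Fin m → ℕ) × ℝ≥0 =>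
        ((fun i => if x.1.1 i ≤ t then x.1.1 i else t + 1 + x.2.1 i : Fin m → ℕ),
          Function.update x.1.2 t x.2.2))
      ((I.law m).prod ((Measure.pi fun _ : Fin m => geometricMeasure I.rate).prod I.valuation))
      (I.law m) := by
  have h1 := measurePreserving_prodProdProdComm (Measure.pi fun _ : Fin m => I.horizon)
    (Measure.infinitePi fun _ : ℕ => I.valuation)
    (Measure.pi fun _ : Fin m => geometricMeasure I.rate) I.valuation
  exact ((I.measurePreserving_horizons_resample m t).prod
    (measurePreserving_update I.valuation t)).comp h1

/-! ### The run of a policy -/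

namespace PricingPolicy

variable {m : ℕ} (P : PricingPolicy m)

lemma sale_congr (r : P.Seed) {H H' : Fin m → ℕ} {X X' : ℕ → ℝ≥0} {t : ℕ} (U : Finset (Fin m))
    (hH : ∀ i, min (H i) (t + 1) = min (H' i) (t + 1)) (hX : ∀ s < t, X s = X' s)
    (hXt : X t = X' t) : P.sale r H X t U = P.sale r H' X' t U := by
  have h1 : (fun i => t < H i) = fun i => t < H' i := by
    funext i
    have := hH i
    exact propext (by omega)
  have h2 : (fun s : Fin t => X s) = fun s : Fin t => X' s := funext fun s => hX s s.2
  have h3 : (fun i => min (H i) (t + 1)) = fun i => min (H' i) (t + 1) := funext hH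
  unfold sale
  simp only [h1, h2, h3, hXt]

lemma unsold_congr (r : P.Seed) {H H' : Fin m → ℕ} {X X' : ℕ → ℝ≥0} {t : ℕ}
    (hH : ∀ i, min (H i) t = min (H' i) t) (hX : ∀ s < t, X s = X' s) :
    P.unsold r H X t = P.unsold r H' X' t := by
  induction t with
  | zero => rfl
  | succ t ih =>
    have h1 := ih (fun i => by have := hH i; omega) (fun s hs => hX s (by omega))
    have h2 := fun U => P.sale_congr r U hH (fun s hs => hX s (by omega)) (hX t (by omega))
    simp only [unsold, h1, h2]

/-- The items that buyer `t` finds present and unsold. -/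
noncomputable def available (r : P.Seed) (H : Fin m → ℕ) (X : ℕ → ℝ≥0) (t : ℕ) : Finset (Fin m) :=
  (P.unsold r H X t).filter fun i => t < H i

/-- The price that buyer `t` faces. -/
noncomputable def currentPrice (r : P.Seed) (H : Fin m → ℕ) (X : ℕ → ℝ≥0) (t : ℕ) : ℝ≥0∞ :=
  P.price t r (fun s => X s) (fun i => min (H i) (t + 1)) (P.available r H X t)

open scoped Classical in
/-- The welfare that buyer `t` contributes. -/
noncomputable def gain (r : P.Seed) (H : Fin m → ℕ) (X : ℕ → ℝ≥0) (t : ℕ) : ℝ≥0∞ :=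
  if (P.sale r H X t (P.unsold r H X t)).isSome then (X t : ℝ≥0∞) else 0

lemma welfare_eq_tsum_gain (r : P.Seed) (H : Fin m → ℕ) (X : ℕ → ℝ≥0) :
    P.welfare r H X = ∑' t, P.gain r H X t := by
  unfold welfare gain
  refine tsum_congr fun t => ?_
  congr

open scoped Classical in
lemma gain_eq (r : P.Seed) (H : Fin m → ℕ) (X : ℕ → ℝ≥0) (t : ℕ) :
    P.gain r H X t = if (P.available r H X t).Nonempty ∧ P.currentPrice r H X t ≤ X t
      then (X t : ℝ≥0∞) else 0 := by
  unfold gain sale currentPrice available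
  by_cases h : ((P.unsold r H X t).filter fun i => t < H i).Nonempty ∧
    P.price t r (fun s => X s) (fun i => min (H i) (t + 1))
      ((P.unsold r H X t).filter fun i => t < H i) ≤ X t
  · simp [h]
  · simp only [dif_neg h, if_neg h]; simp

lemma available_succ_subset (r : P.Seed) (H : Fin m → ℕ) (X : ℕ → ℝ≥0) (t : ℕ) :
    P.available r H X (t + 1) ⊆ (P.available r H X t).filter fun i => t + 1 < H i := by
  intro i hi
  simp only [available, unsold, Finset.mem_filter] at hi ⊢
  exact ⟨⟨hi.1.1, by omega⟩, hi.2⟩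

/-- A sale removes an item that does not depend on the valuation of the buyer. -/
lemma exists_sold (r : P.Seed) (H : Fin m → ℕ) (X : ℕ → ℝ≥0) (t : ℕ)
    (hA : (P.available r H X t).Nonempty) :
    ∃ i ∈ P.available r H X t, ∀ H' X', (∀ j, min (H' j) (t + 1) = min (H j) (t + 1)) →
      (∀ s < t, X' s = X s) → P.currentPrice r H X t ≤ X' t → i ∉ P.available r H' X' (t + 1) := by
  refine ⟨P.select t r (fun s => X s) (fun i => min (H i) (t + 1)) _ hA, P.select_mem .., ?_⟩
  intro H' X' hH hX hp hi
  simp only [available, unsold, Finset.mem_filter] at hi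
  apply hi.1.2
  have h1 : P.unsold r H' X' t = P.unsold r H X t :=
    P.unsold_congr r (fun i => by have := hH i; omega) hX
  have h2 : (fun i => t < H' i) = fun i => t < H i := by
    funext i
    have := hH i
    exact propext (by omega)
  have h3 : (fun i => min (H' i) (t + 1)) = fun i => min (H i) (t + 1) := funext hH
  have h4 : (fun s : Fin t => X' s) = fun s : Fin t => X s := funext fun s => hX s s.2
  unfold sale
  simp only [h1, h2, h3, h4]
  rw [dif_pos]
  exact ⟨hA, hp⟩

lemma measurableSet_sale_eq (r : P.Seed) (H : Fin m → ℕ) (t : ℕ) (U : Finset (Fin m))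
    (o : Option (Fin m)) : MeasurableSet {X | P.sale r H X t U = o} := by
  classical
  have hpast : Measurable fun X : ℕ → ℝ≥0 =>
      (r, (fun s : Fin t => X s), fun i => min (H i) (t + 1)) := by fun_prop
  by_cases hA : (U.filter fun i => t < H i).Nonempty
  · have hp : MeasurableSet {X : ℕ → ℝ≥0 |
        P.price t r (fun s => X s) (fun i => min (H i) (t + 1))
          (U.filter fun i => t < H i) ≤ X t} :=
      measurableSet_le ((P.measurable_price t _).comp hpast) (by fun_prop)
    have hs : ∀ i, MeasurableSet {X : ℕ → ℝ≥0 |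
        P.select t r (fun s => X s) (fun i => min (H i) (t + 1))
          (U.filter fun i => t < H i) hA = i} := fun i =>
      ((P.measurable_select t _ hA).comp hpast) (measurableSet_singleton i)
    cases o with
    | none =>
      convert hp.compl using 1
      ext X
      simp only [sale, Set.mem_ofPred_eq, Set.mem_compl_iff]
      by_cases h : P.price t r (fun s => X s) (fun i => min (H i) (t + 1))
        (U.filter fun i => t < H i) ≤ X t
      · simp [hA, h]
      · simp [h]
    | some i =>
      convert hp.inter (hs i) using 1
      ext X
      simp only [sale, Set.mem_ofPred_eq, Set.mem_inter_iff]
      by_cases h : P.price t r (fun s => X s) (fun i => min (H i) (t + 1))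
        (U.filter fun i => t < H i) ≤ X t
      · simp [hA, h]
      · simp [h]
  · convert MeasurableSet.const (none = o) using 1
    ext X
    simp only [sale, Set.mem_ofPred_eq]
    simp [hA]

lemma measurableSet_unsold_eq (r : P.Seed) (H : Fin m → ℕ) (t : ℕ) (U : Finset (Fin m)) :
    MeasurableSet {X | P.unsold r H X t = U} := by
  classical
  induction t generalizing U with
  | zero => exact MeasurableSet.const (Finset.univ = U)
  | succ t ih =>
    have : {X | P.unsold r H X (t + 1) = U} = ⋃ U', ⋃ o, ⋃ (_ : (Finset.filter
        (fun i => o ≠ some i) U') = U),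
          {X | P.unsold r H X t = U'} ∩ {X | P.sale r H X t U' = o} := by
      ext X
      simp only [unsold, Set.mem_ofPred_eq, Set.mem_iUnion, Set.mem_inter_iff, exists_prop]
      constructor
      · intro h
        exact ⟨_, _, h, rfl, rfl⟩
      · rintro ⟨_, _, h, rfl, rfl⟩
        exact h
    rw [this]
    exact MeasurableSet.iUnion fun U' => MeasurableSet.iUnion fun o => MeasurableSet.iUnion fun _ =>
      (ih U').inter (P.measurableSet_sale_eq r H t U' o)

lemma measurable_gain (r : P.Seed) (t : ℕ) :
    Measurable fun ω : (Fin m → ℕ) × (ℕ → ℝ≥0) => P.gain r ω.1 ω.2 t := by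
  classical
  refine measurable_from_prod_countable_right fun H => ?_
  have : MeasurableSet {X | (P.sale r H X t (P.unsold r H X t)).isSome = true} := by
    have h : {X | (P.sale r H X t (P.unsold r H X t)).isSome = true} = ⋃ U,
        {X | P.unsold r H X t = U} ∩ {X | P.sale r H X t U = none}ᶜ := by
      ext X
      simp [Option.isSome_iff_ne_none]
    rw [h]
    exact MeasurableSet.iUnion fun U => (P.measurableSet_unsold_eq r H t U).inter
      (P.measurableSet_sale_eq r H t U none).compl
  exact Measurable.ite this (by fun_prop) measurable_const

end PricingPolicy

/-- The potential `δ 0 + ⋯ + δ (k - 1)` drops by at least `δ k` for each of the items lost from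
`k + 1` items. -/
lemma sum_range_card_add_le {ι : Type*} {δ : ℕ → ℝ≥0∞} (hδ : Antitone δ) {k : ℕ} (A S : Finset ι)
    (hA : A.card = k + 1) (L : ℕ) (hS : S.card + L ≤ A.card) :
    ∑ j ∈ Finset.range S.card, δ j + L * δ k ≤ ∑ j ∈ Finset.range A.card, δ j := by
  have h1 : ∑ j ∈ Finset.range (S.card + L), δ j ≤ ∑ j ∈ Finset.range A.card, δ j :=
    Finset.sum_le_sum_of_subset (Finset.range_mono hS)
  refine le_trans ?_ h1
  rw [Finset.sum_range_add]
  gcongr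
  calc (L : ℝ≥0∞) * δ k = ∑ j ∈ Finset.range L, δ k := by simp
    _ ≤ _ := Finset.sum_le_sum fun j hj => hδ (by rw [Finset.mem_range] at hj; omega)

/-! ### An upper bound on the welfare of a policy -/

namespace GeometricInstance

variable (I : GeometricInstance)

/-- The law of what is drawn afresh at each step: the remaining horizons of the items and the
valuation of the next buyer. -/
noncomputable def stepLaw (m : ℕ) : Measure ((Fin m → ℕ) × ℝ≥0) :=
  (Measure.pi fun _ : Fin m => geometricMeasure I.rate).prod I.valuation

instance (m : ℕ) : IsProbabilityMeasure (I.stepLaw m) := by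
  unfold stepLaw; infer_instance

lemma geometric_ne_zero : geometricMeasure I.rate {n | n ≠ 0} = I.surv := by
  have h0 : geometricMeasure I.rate {0} = I.dep := by simpa using I.geometric_singleton 0
  have h := prob_add_prob_compl (μ := geometricMeasure I.rate) (measurableSet_singleton (0 : ℕ))
  rw [h0, ← I.dep_add_surv] at h
  exact (ENNReal.add_right_inj ENNReal.ofReal_ne_top).1 h

lemma stepLaw_eq_zero {m : ℕ} (i : Fin m) : I.stepLaw m {x | x.1 i = 0} = I.dep := by
  have h := (measurePreserving_eval (fun _ : Fin m => geometricMeasure I.rate) i).comp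
    (measurePreserving_fst (μ := Measure.pi fun _ : Fin m => geometricMeasure I.rate)
      (ν := I.valuation))
  have h2 := h.measure_preimage (s := {0}) (measurableSet_singleton (0 : ℕ)).nullMeasurableSet
  rw [I.geometric_singleton, pow_zero, one_mul] at h2
  exact h2

lemma stepLaw_ne_zero {m : ℕ} (i : Fin m) (s : Set ℝ≥0) :
    I.stepLaw m {x | x.2 ∈ s ∧ x.1 i ≠ 0} = I.surv * I.valuation s := by
  have h : {x : (Fin m → ℕ) × ℝ≥0 | x.2 ∈ s ∧ x.1 i ≠ 0} = {N | N i ≠ 0} ×ˢ s := by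
    ext x; simp [and_comm]
  rw [h, stepLaw, Measure.prod_prod]
  congr 1
  rw [← I.geometric_ne_zero]
  exact (measurePreserving_eval (fun _ : Fin m => geometricMeasure I.rate) i).measure_preimage
    (s := {n | n ≠ 0}) (MeasurableSet.of_discrete.nullMeasurableSet)

end GeometricInstance

open scoped Classical in
/-- One step of the potential argument, with `k + 1` items available in `A` and the price `p`: by
`h`, the losses of potential by departures and by the sale of item `i` cover the expected welfare of
the sale. Here `x` is the draw of the remaining horizons and of the valuation, and `S x` holds the
items available to the next buyer. An item `i` that is sold counts as a loss only if it would have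
stayed, since otherwise it is counted as a departure. -/
lemma lintegral_step_le (I : GeometricInstance) {m : ℕ} {δ : ℕ → ℝ≥0∞} (hδ : Antitone δ)
    {k : ℕ} {A : Finset (Fin m)} (hA : A.card = k + 1) {i : Fin m} (hi : i ∈ A) (p : ℝ≥0∞)
    (h : ∫⁻ x in {x : ℝ≥0 | p ≤ x}, (x : ℝ≥0∞) ∂I.valuation ≤
      ((k + 1 : ℕ) * I.dep + I.surv * I.valuation {x | p ≤ x}) * δ k)
    (S : (Fin m → ℕ) × ℝ≥0 → Finset (Fin m)) (hS : ∀ x, S x ⊆ A.filter fun j => x.1 j ≠ 0)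
    (hSi : ∀ x, p ≤ x.2 → i ∉ S x) :
    ∫⁻ x, (if p ≤ x.2 then (x.2 : ℝ≥0∞) else 0) + ∑ j ∈ Finset.range (S x).card, δ j ∂I.stepLaw m ≤
      ∑ j ∈ Finset.range A.card, δ j := by
  have hpm : MeasurableSet {x : ℝ≥0 | p ≤ x} := measurableSet_le measurable_const (by fun_prop)
  have hzm : ∀ j, MeasurableSet {x : (Fin m → ℕ) × ℝ≥0 | x.1 j = 0} := fun j =>
    measurableSet_eq_fun ((measurable_pi_apply j).comp measurable_fst) measurable_const
  have hpm2 : MeasurableSet {x : (Fin m → ℕ) × ℝ≥0 | x.2 ∈ {y : ℝ≥0 | p ≤ y} ∧ x.1 i ≠ 0} :=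
    (measurable_snd hpm).inter (hzm i).compl
  set L : (Fin m → ℕ) × ℝ≥0 → ℝ≥0∞ := fun x =>
    (∑ j ∈ A, Set.indicator {x : (Fin m → ℕ) × ℝ≥0 | x.1 j = 0} 1 x +
      Set.indicator {x : (Fin m → ℕ) × ℝ≥0 | x.2 ∈ {y : ℝ≥0 | p ≤ y} ∧ x.1 i ≠ 0} 1 x) * δ k with hL
  have hLm : Measurable L := Measurable.mul_const (Measurable.add
    (Finset.measurable_fun_sum _ fun j _ => measurable_one.indicator (hzm j))
    (measurable_one.indicator hpm2)) _
  have hLint : ∫⁻ x, L x ∂I.stepLaw m =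
      ((k + 1 : ℕ) * I.dep + I.surv * I.valuation {x | p ≤ x}) * δ k := by
    have h1 : Measurable fun x : (Fin m → ℕ) × ℝ≥0 =>
        Set.indicator {x : (Fin m → ℕ) × ℝ≥0 | x.2 ∈ {y : ℝ≥0 | p ≤ y} ∧ x.1 i ≠ 0}
          (1 : (Fin m → ℕ) × ℝ≥0 → ℝ≥0∞) x := measurable_one.indicator hpm2
    have h2 : ∀ j ∈ A, Measurable fun x : (Fin m → ℕ) × ℝ≥0 =>
        Set.indicator {x : (Fin m → ℕ) × ℝ≥0 | x.1 j = 0} (1 : (Fin m → ℕ) × ℝ≥0 → ℝ≥0∞) x :=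
      fun j _ => measurable_one.indicator (hzm j)
    have h3 : Measurable fun x : (Fin m → ℕ) × ℝ≥0 =>
        ∑ j ∈ A, Set.indicator {x : (Fin m → ℕ) × ℝ≥0 | x.1 j = 0}
          (1 : (Fin m → ℕ) × ℝ≥0 → ℝ≥0∞) x +
        Set.indicator {x : (Fin m → ℕ) × ℝ≥0 | x.2 ∈ {y : ℝ≥0 | p ≤ y} ∧ x.1 i ≠ 0}
          (1 : (Fin m → ℕ) × ℝ≥0 → ℝ≥0∞) x :=
      (Finset.measurable_fun_sum _ h2).add h1
    simp only [hL]
    rw [lintegral_mul_const _ h3,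
      lintegral_add_right _ h1, lintegral_finsetSum _ h2,
      lintegral_indicator_one hpm2, I.stepLaw_ne_zero]
    simp_rw [lintegral_indicator_one (hzm _), I.stepLaw_eq_zero]
    simp [hA]
  have hpt : ∀ x, ∑ j ∈ Finset.range (S x).card, δ j + L x ≤ ∑ j ∈ Finset.range A.card, δ j := by
    intro x
    have hLx : L x = (((A.filter fun j => x.1 j = 0).card +
        (if p ≤ x.2 ∧ x.1 i ≠ 0 then 1 else 0) : ℕ) : ℝ≥0∞) * δ k := by
      simp only [hL, Finset.card_filter]
      push_cast
      congr 2
      · exact Finset.sum_congr rfl fun j _ => by simp only [Set.indicator_apply]; rfl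
      · simp only [Set.indicator_apply]; rfl
    rw [hLx]
    refine sum_range_card_add_le hδ A (S x) hA _ ?_
    have h1 := Finset.card_filter_add_card_filter_not (s := A) (fun j => x.1 j = 0)
    have h2 : (S x).card + (if p ≤ x.2 ∧ x.1 i ≠ 0 then 1 else 0) ≤
        (A.filter fun j => ¬ x.1 j = 0).card := by
      split_ifs with hc
      · have : S x ⊆ (A.filter fun j => ¬ x.1 j = 0).erase i := fun j hj =>
          Finset.mem_erase.2 ⟨fun h => hSi x hc.1 (h ▸ hj), hS x hj⟩
        have h3 := Finset.card_le_card this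
        have h4 : i ∈ A.filter fun j => ¬ x.1 j = 0 := Finset.mem_filter.2 ⟨hi, hc.2⟩
        rw [Finset.card_erase_of_mem h4] at h3
        have := Finset.card_pos.2 ⟨i, h4⟩
        omega
      · exact Finset.card_le_card (hS x)
    omega
  have hg : ∫⁻ x, (if p ≤ x.2 then (x.2 : ℝ≥0∞) else 0) ∂I.stepLaw m =
      ∫⁻ x in {x : ℝ≥0 | p ≤ x}, (x : ℝ≥0∞) ∂I.valuation := by
    have hmeas : Measurable fun y : ℝ≥0 => if p ≤ y then (y : ℝ≥0∞) else 0 :=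
      Measurable.ite hpm (by fun_prop) measurable_const
    rw [← lintegral_indicator hpm]
    have := (measurePreserving_snd (μ := Measure.pi fun _ : Fin m => geometricMeasure I.rate)
      (ν := I.valuation)).lintegral_comp hmeas
    rw [GeometricInstance.stepLaw, this]
    exact lintegral_congr fun y => by simp [Set.indicator_apply]
  calc ∫⁻ x, (if p ≤ x.2 then (x.2 : ℝ≥0∞) else 0) + ∑ j ∈ Finset.range (S x).card, δ j ∂I.stepLaw m
      = ∫⁻ x in {x : ℝ≥0 | p ≤ x}, (x : ℝ≥0∞) ∂I.valuation +
        ∫⁻ x, ∑ j ∈ Finset.range (S x).card, δ j ∂I.stepLaw m := by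
        rw [lintegral_add_left, hg]
        exact Measurable.ite (measurable_snd hpm) (by fun_prop) measurable_const
    _ ≤ ∫⁻ x, ∑ j ∈ Finset.range (S x).card, δ j ∂I.stepLaw m + ∫⁻ x, L x ∂I.stepLaw m := by
        rw [add_comm, hLint]; gcongr
    _ = ∫⁻ x, ∑ j ∈ Finset.range (S x).card, δ j + L x ∂I.stepLaw m :=
        (lintegral_add_right _ hLm).symm
    _ ≤ ∫⁻ _, ∑ j ∈ Finset.range A.card, δ j ∂I.stepLaw m := lintegral_mono hpt
    _ = _ := by simp

namespace PricingPolicy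

variable {m : ℕ} (P : PricingPolicy m)

open scoped Classical in
/-- The expected welfare collected so far plus the potential of the items left does not grow. -/
lemma lintegral_gain_add_potential_le (I : GeometricInstance) (r : P.Seed) {δ : ℕ → ℝ≥0∞}
    (hδ : Antitone δ)
    (h : ∀ k < m, ∀ t past obs A,
      ∫⁻ x in {x : ℝ≥0 | P.price t r past obs A ≤ x}, (x : ℝ≥0∞) ∂I.valuation ≤
      ((k + 1 : ℕ) * I.dep + I.surv * I.valuation {x | P.price t r past obs A ≤ x}) * δ k) (t : ℕ) :
    ∫⁻ ω, ∑ s ∈ Finset.range t, P.gain r ω.1 ω.2 s +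
      ∑ j ∈ Finset.range (P.available r ω.1 ω.2 t).card, δ j ∂I.law m ≤
      ∑ j ∈ Finset.range m, δ j := by
  induction t with
  | zero =>
    calc _ ≤ ∫⁻ _, ∑ j ∈ Finset.range m, δ j ∂I.law m := by
          refine lintegral_mono fun ω => ?_
          simp only [Finset.range_zero, Finset.sum_empty, zero_add]
          exact Finset.sum_le_sum_of_subset (Finset.range_mono (by
            simpa using Finset.card_le_univ (P.available r ω.1 ω.2 0)))
      _ = _ := by simp
  | succ t ih =>
    refine le_trans ?_ ih
    conv_lhs => rw [← (I.measurePreserving_resample m t).map_eq]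
    -- Neither inequality needs the integrand to be measurable.
    refine (lintegral_map_le _ _).trans ((lintegral_prod_le _).trans (lintegral_mono ?_))
    rintro ⟨H, X⟩
    set H' : (Fin m → ℕ) × ℝ≥0 → Fin m → ℕ := fun x i => if H i ≤ t then H i else t + 1 + x.1 i
      with hH'
    set X' : (Fin m → ℕ) × ℝ≥0 → ℕ → ℝ≥0 := fun x => Function.update X t x.2 with hX'
    have eH : ∀ x i, min (H' x i) (t + 1) = min (H i) (t + 1) := by
      intro x i; simp only [hH']; split_ifs <;> omega
    have eX : ∀ x, ∀ s < t, X' x s = X s := by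
      intro x s hs; simp [hX', hs.ne]
    have eU : ∀ x, ∀ s ≤ t, P.unsold r (H' x) (X' x) s = P.unsold r H X s := fun x s hs =>
      P.unsold_congr r (fun i => by have := eH x i; omega) (fun u hu => eX x u (by omega))
    have eA : ∀ x, P.available r (H' x) (X' x) t = P.available r H X t := by
      intro x
      unfold available
      rw [eU x t le_rfl]
      refine Finset.filter_congr fun i _ => ?_
      have := eH x i
      omega
    have eP : ∀ x, P.currentPrice r (H' x) (X' x) t = P.currentPrice r H X t := by
      intro x
      unfold currentPrice
      rw [eA x, show (fun i => min (H' x i) (t + 1)) = fun i => min (H i) (t + 1) from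
        funext (eH x), show (fun s : Fin t => X' x s) = fun s : Fin t => X s from
        funext fun s => eX x s s.2]
    have eG : ∀ x, ∀ s < t, P.gain r (H' x) (X' x) s = P.gain r H X s := by
      intro x s hs
      unfold gain
      rw [eU x s hs.le, P.sale_congr r (H' := H) (X' := X) _ (fun i => by have := eH x i; omega)
        (fun u hu => eX x u (by omega)) (eX x s hs), eX x s hs]
    have eS : ∀ x, ∑ s ∈ Finset.range (t + 1), P.gain r (H' x) (X' x) s =
        ∑ s ∈ Finset.range t, P.gain r H X s +
          if (P.available r H X t).Nonempty ∧ P.currentPrice r H X t ≤ x.2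
          then (x.2 : ℝ≥0∞) else 0 := by
      intro x
      rw [Finset.sum_range_succ, P.gain_eq r _ _ t, eA, eP]
      congr 1
      · exact Finset.sum_congr rfl fun s hs => eG x s (Finset.mem_range.1 hs)
      · simp [hX']
    have hsub : ∀ x, P.available r (H' x) (X' x) (t + 1) ⊆
        (P.available r H X t).filter fun j => x.1 j ≠ 0 := by
      intro x j hj
      have h1 := P.available_succ_subset r _ _ t hj
      rw [eA] at h1
      rw [Finset.mem_filter] at h1 ⊢
      refine ⟨h1.1, ?_⟩
      have h2 : t < H j := (Finset.mem_filter.1 h1.1).2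
      have h3 := h1.2
      simp only [hH'] at h3
      split_ifs at h3 <;> omega
    change ∫⁻ x, ∑ s ∈ Finset.range (t + 1), P.gain r (H' x) (X' x) s +
      ∑ j ∈ Finset.range (P.available r (H' x) (X' x) (t + 1)).card, δ j ∂I.stepLaw m ≤ _
    simp_rw [eS, add_assoc]
    rw [lintegral_add_left measurable_const, lintegral_const, measure_univ, mul_one]
    gcongr
    -- For fixed past `(H, X)`, only the welfare of buyer `t` and the new potential are random.
    by_cases hA : (P.available r H X t).Nonempty
    · obtain ⟨i, hi, hsold⟩ := P.exists_sold r H X t hA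
      obtain ⟨k, hk⟩ : ∃ k, (P.available r H X t).card = k + 1 :=
        ⟨_, (Nat.succ_pred_eq_of_pos hA.card_pos).symm⟩
      have hkm : k < m := by
        have := Finset.card_le_univ (P.available r H X t)
        simp at this; omega
      simp only [hA, true_and]
      refine lintegral_step_le I hδ hk hi _ (h k hkm t _ _ _) _ hsub fun x hx => ?_
      refine hsold _ _ (eH x) (eX x) ?_
      simp only [hX', Function.update_self]
      exact hx
    · rw [Finset.not_nonempty_iff_eq_empty] at hA
      have : ∀ x, P.available r (H' x) (X' x) (t + 1) = ∅ := fun x => by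
        simpa [hA] using hsub x
      simp [hA, this]

/-- An upper bound on what a policy can earn: if `δ k` is at least the value of keeping the last of
`k + 1` items, in the sense that the losses of a step cover the expected welfare of a sale at any
price that the policy may post, then the expected welfare is at most `δ 0 + ⋯ + δ (m - 1)`. -/
theorem lintegral_welfare_le (I : GeometricInstance) (r : P.Seed) {δ : ℕ → ℝ≥0∞}
    (hδ : Antitone δ)
    (h : ∀ k < m, ∀ t past obs A,
      ∫⁻ x in {x : ℝ≥0 | P.price t r past obs A ≤ x}, (x : ℝ≥0∞) ∂I.valuation ≤
      ((k + 1 : ℕ) * I.dep + I.surv * I.valuation {x | P.price t r past obs A ≤ x}) * δ k) :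
    ∫⁻ ω, P.welfare r ω.1 ω.2 ∂I.law m ≤ ∑ j ∈ Finset.range m, δ j := by
  simp_rw [P.welfare_eq_tsum_gain, ENNReal.tsum_eq_iSup_nat]
  rw [lintegral_iSup (fun t => Finset.measurable_fun_sum _ fun s _ => P.measurable_gain r s)
    (fun a b hab ω => Finset.sum_le_sum_of_subset (Finset.range_mono hab))]
  refine iSup_le fun t => le_trans (lintegral_mono fun ω => ?_)
    (P.lintegral_gain_add_potential_le I r hδ h t)
  exact le_self_add

theorem value_le (I : GeometricInstance) {v : ℝ≥0∞}
    (h : ∀ r, ∫⁻ ω, P.welfare r ω.1 ω.2 ∂I.law m ≤ v) : P.value I ≤ v := by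
  refine (lintegral_prod_le _).trans ((lintegral_mono h).trans ?_)
  simp

end PricingPolicy

lemma PricingScheme.le_competitiveRatio {m : ℕ} (S : PricingScheme m) (I : GeometricInstance)
    {b v : ℝ≥0∞} (hv0 : v ≠ 0) (hv : v ≠ ∞) (h : (S I).value I ≤ v) (hb : b * v ≤ I.prophet m) :
    b ≤ S.competitiveRatio := by
  refine le_sInf fun c hc => ?_
  have h1 : b * v ≤ c * v := hb.trans ((hc I).trans (by gcongr))
  exact (ENNReal.mul_le_mul_iff_left hv0 hv).1 h1

/-! ### Serving blocks of buyers -/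

/-- Any injective assignment of buyers to items that are present for them bounds the welfare of the
prophet from below. -/
lemma sum_le_prophetWelfare {m : ℕ} {H : Fin m → ℕ} {X : ℕ → ℝ≥0} (B : Finset ℕ) (f : ℕ → Fin m)
    (hf : Set.InjOn f B) (hH : ∀ t ∈ B, t < H (f t)) :
    ∑ t ∈ B, (X t : ℝ≥0∞) ≤ prophetWelfare H X := by
  classical
  set M : Fin m → Option ℕ := fun i => if h : ∃ t ∈ B, f t = i then some h.choose else none with hM
  have hMs : ∀ i t, M i = some t → t ∈ B ∧ f t = i := by
    intro i t h
    simp only [hM] at h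
    split_ifs at h with h'
    · obtain rfl := Option.some.inj h
      exact h'.choose_spec
  have hMf : ∀ t ∈ B, M (f t) = some t := by
    intro t ht
    have h' : ∃ s ∈ B, f s = f t := ⟨t, ht, rfl⟩
    simp only [hM, dif_pos h']
    exact congrArg some (hf h'.choose_spec.1 ht h'.choose_spec.2)
  have hmatch : IsMatching H M := by
    refine ⟨fun i j t hi hj => ?_, fun i t hi => ?_⟩
    · rw [← (hMs i t hi).2, (hMs j t hj).2]
    · have := hMs i t hi
      rw [← this.2]; exact hH t this.1
  refine le_trans ?_ (le_iSup₂_of_le M hmatch le_rfl)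
  unfold matchingWelfare
  calc ∑ t ∈ B, (X t : ℝ≥0∞) = ∑ t ∈ B, (M (f t)).elim 0 fun t => (X t : ℝ≥0∞) :=
        Finset.sum_congr rfl fun t ht => by rw [hMf t ht]; rfl
    _ = ∑ i ∈ B.image f, (M i).elim 0 fun t => (X t : ℝ≥0∞) :=
        (Finset.sum_image (f := fun i => ((M i).elim 0 fun t => (X t : ℝ≥0∞) : ℝ≥0∞))
          fun a ha b hb h => hf ha hb h).symm
    _ ≤ _ := Finset.sum_le_sum_of_subset (Finset.subset_univ _)

/-- The buyers of block `j` (of length `n`) whose valuation is at least `x`. -/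
noncomputable def blockBuyers (n j : ℕ) (x : ℝ≥0) (X : ℕ → ℝ≥0) : Finset ℕ :=
  (Finset.Ico (j * n) ((j + 1) * n)).filter fun t => x ≤ X t

/-- The items that depart during the block after block `j`. -/
def blockItems {m : ℕ} (n j : ℕ) (H : Fin m → ℕ) : Finset (Fin m) :=
  Finset.univ.filter fun i => (j + 1) * n < H i ∧ H i ≤ (j + 2) * n

lemma sum_blocks_le_prophetWelfare {m : ℕ} (n J : ℕ) (x : ℕ → ℝ≥0) (H : Fin m → ℕ)
    (X : ℕ → ℝ≥0) :
    ∑ j ∈ Finset.range J, (if (blockBuyers n j (x j) X).card ≤ (blockItems n j H).card then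
      ∑ t ∈ blockBuyers n j (x j) X, (X t : ℝ≥0∞) else 0) ≤ prophetWelfare H X := by
  classical
  rcases Nat.eq_zero_or_pos m with rfl | hm
  · refine le_trans (le_of_eq (Finset.sum_eq_zero fun j _ => ?_)) zero_le
    split_ifs with h
    · have : (blockItems n j H).card = 0 := by
        rw [Finset.card_eq_zero]; ext i; exact i.elim0
      rw [this, Nat.le_zero, Finset.card_eq_zero] at h
      simp [h]
    · rfl
  have key : ∀ j, ∃ e : ℕ → Fin m, (blockBuyers n j (x j) X).card ≤ (blockItems n j H).card →
      Set.InjOn e (blockBuyers n j (x j) X) ∧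
        ∀ t ∈ blockBuyers n j (x j) X, e t ∈ blockItems n j H := by
    intro j
    by_cases h : (blockBuyers n j (x j) X).card ≤ (blockItems n j H).card
    · obtain ⟨g⟩ : Nonempty (blockBuyers n j (x j) X ↪ blockItems n j H) :=
        Function.Embedding.nonempty_of_card_le (by simpa using h)
      refine ⟨fun t => if ht : t ∈ blockBuyers n j (x j) X then g ⟨t, ht⟩ else ⟨0, hm⟩,
        fun _ => ⟨fun a ha b hb hab => ?_, fun t ht => ?_⟩⟩
      · simp only [Finset.mem_coe] at ha hb
        simp only [dif_pos ha, dif_pos hb] at hab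
        have := g.injective (Subtype.ext hab)
        simpa using this
      · simp only [dif_pos ht]
        exact (g ⟨t, ht⟩).2
    · exact ⟨fun _ => ⟨0, hm⟩, fun h' => absurd h' h⟩
  choose e he using key
  set K := (Finset.range J).filter fun j =>
    (blockBuyers n j (x j) X).card ≤ (blockItems n j H).card with hK
  have hdiv : ∀ j, ∀ t ∈ blockBuyers n j (x j) X, t / n = j := by
    intro j t ht
    have h1 := Finset.mem_Ico.1 (Finset.mem_filter.1 ht).1
    exact Nat.div_eq_of_lt_le (by omega) (by simpa using h1.2)
  have hdisj : (K : Set ℕ).PairwiseDisjoint fun j => blockBuyers n j (x j) X := by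
    intro a _ b _ hab
    refine Finset.disjoint_left.2 fun t hta htb => hab ?_
    rw [← hdiv a t hta, hdiv b t htb]
  have hmem : ∀ t ∈ K.biUnion fun j => blockBuyers n j (x j) X,
      t / n ∈ K ∧ t ∈ blockBuyers n (t / n) (x (t / n)) X := by
    intro t ht
    obtain ⟨j, hj, htj⟩ := Finset.mem_biUnion.1 ht
    rw [hdiv j t htj]; exact ⟨hj, htj⟩
  have hitem : ∀ t ∈ K.biUnion fun j => blockBuyers n j (x j) X,
      e (t / n) t ∈ blockItems n (t / n) H := fun t ht =>
    (he _ (Finset.mem_filter.1 (hmem t ht).1).2).2 t (hmem t ht).2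
  rw [← Finset.sum_filter, ← Finset.sum_biUnion hdisj]
  refine sum_le_prophetWelfare _ (fun t => e (t / n) t) ?_ ?_
  · intro a ha b hb hab
    simp only [Finset.mem_coe] at ha hb
    have h1 := (Finset.mem_filter.1 (hitem a ha)).2
    have h2 := (Finset.mem_filter.1 (hitem b hb)).2
    simp only at hab
    rw [hab] at h1
    have hd : a / n = b / n := by
      rcases lt_trichotomy (a / n) (b / n) with h | h | h
      · have : (a / n + 2) * n ≤ (b / n + 1) * n := Nat.mul_le_mul_right _ (by omega)
        omega
      · exact h
      · have : (b / n + 2) * n ≤ (a / n + 1) * n := Nat.mul_le_mul_right _ (by omega)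
        omega
    refine (he _ (Finset.mem_filter.1 (hmem a ha).1).2).1 (hmem a ha).2 ?_ (by rw [hab, hd])
    rw [hd]; exact (hmem b hb).2
  · intro t ht
    have h1 := (Finset.mem_filter.1 (hitem t ht)).2
    have h2 := Finset.mem_Ico.1 (Finset.mem_filter.1 (hmem t ht).2).1
    omega

/-- Chebyshev's inequality for the number of hits of a set in an i.i.d. sample. -/
lemma measure_card_filter_deviation_le {ι Ω : Type*} [MeasurableSpace Ω] (μ : Measure Ω)
    [IsProbabilityMeasure μ] (s : Finset ι) {A : Set Ω} (hA : MeasurableSet A)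
    [DecidablePred (· ∈ A)] {d : ℝ} (hd : 0 < d) :
    Measure.infinitePi (fun _ : ι => μ)
      {Y | d ≤ |((s.filter fun i => Y i ∈ A).card : ℝ) - s.card * μ.real A|} ≤
      ENNReal.ofReal (s.card * μ.real A / d ^ 2) := by
  set P := Measure.infinitePi (fun _ : ι => μ)
  set Z : ι → (ι → Ω) → ℝ := fun i Y => A.indicator 1 (Y i) with hZ
  have hind : Measurable (A.indicator (1 : Ω → ℝ)) := measurable_one.indicator hA
  have hZm : ∀ i, Measurable (Z i) := fun i => hind.comp (measurable_pi_apply i)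
  have hZb : ∀ i Y, ‖Z i Y‖ ≤ 1 := by
    intro i Y
    simp only [hZ, Set.indicator_apply]
    split_ifs <;> simp
  have hZL : ∀ i, MemLp (Z i) 2 P := fun i =>
    MemLp.of_bound (hZm i).aestronglyMeasurable 1 (Filter.Eventually.of_forall (hZb i))
  have hZint : ∀ i, ∫ Y, Z i Y ∂P = μ.real A := by
    intro i
    have h := (measurePreserving_eval_infinitePi (fun _ : ι => μ) i)
    have h2 := integral_map (μ := P) h.measurable.aemeasurable (f := A.indicator (1 : Ω → ℝ))
      (by rw [h.map_eq]; exact hind.aestronglyMeasurable)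
    rw [h.map_eq, integral_indicator_one hA] at h2
    exact h2.symm
  have hind2 : iIndepFun Z P :=
    iIndepFun_infinitePi (P := fun _ : ι => μ) (X := fun _ => A.indicator (1 : Ω → ℝ)) fun _ => hind
  have hvar : Var[∑ i ∈ s, Z i; P] ≤ s.card * μ.real A := by
    rw [IndepFun.variance_sum (fun i _ => hZL i) (fun i _ j _ hij => hind2.indepFun hij)]
    calc ∑ i ∈ s, Var[Z i; P] ≤ ∑ i ∈ s, μ.real A := by
          refine Finset.sum_le_sum fun i _ => ?_
          refine (variance_le_expectation_sq (hZm i).aestronglyMeasurable).trans (le_of_eq ?_)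
          rw [← hZint i]
          refine integral_congr_ae (Filter.Eventually.of_forall fun Y => ?_)
          simp only [hZ, Pi.pow_apply, Set.indicator_apply]
          split_ifs <;> simp
      _ = _ := by simp
  have hmean : ∫ Y, (∑ i ∈ s, Z i) Y ∂P = s.card * μ.real A := by
    simp_rw [Finset.sum_apply]
    rw [integral_finsetSum _ fun i _ => (hZL i).integrable (by norm_num)]
    simp [hZint]
  have hsum : ∀ Y, (∑ i ∈ s, Z i) Y = ((s.filter fun i => Y i ∈ A).card : ℝ) := by
    intro Y
    simp [hZ, Finset.sum_apply, Set.indicator_apply, Finset.sum_boole]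
  have hcheb := meas_ge_le_variance_div_sq (memLp_finsetSum' s fun i _ => hZL i) hd
  rw [hmean] at hcheb
  simp_rw [hsum] at hcheb
  exact hcheb.trans (ENNReal.ofReal_le_ofReal (by gcongr))

/-! ### The prophet against block thresholds -/

namespace GeometricInstance

variable (I : GeometricInstance)

lemma horizon_Ioc (a b : ℕ) (hab : a ≤ b) :
    I.horizon.real (Set.Ioc a b) = (1 - I.rate : ℝ) ^ a - (1 - I.rate : ℝ) ^ b := by
  have h : ∀ t, I.horizon.real (Set.Ioi t) = (1 - I.rate : ℝ) ^ t := fun t => by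
    have := I.rate.2.2
    rw [measureReal_def, I.horizon_Ioi, ENNReal.toReal_pow, surv,
      ENNReal.toReal_ofReal (by linarith)]
  rw [← h a, ← h b, ← measureReal_sdiff (Set.Ioi_subset_Ioi hab) measurableSet_Ioi]
  congr 1
  ext n; simp

lemma measurePreserving_update_valuation (m t : ℕ) :
    MeasurePreserving
      (fun x : ((Fin m → ℕ) × (ℕ → ℝ≥0)) × ℝ≥0 => (x.1.1, Function.update x.1.2 t x.2))
      ((I.law m).prod I.valuation) (I.law m) := by
  have h1 := measurePreserving_prodAssoc (Measure.pi fun _ : Fin m => I.horizon)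
    (Measure.infinitePi fun _ : ℕ => I.valuation) I.valuation
  exact ((MeasurePreserving.id _).prod (measurePreserving_update I.valuation t)).comp h1

end GeometricInstance

lemma measurableSet_blockBuyers_card_add_le {m : ℕ} (n j a : ℕ) (x : ℝ≥0) :
    MeasurableSet {ω : (Fin m → ℕ) × (ℕ → ℝ≥0) |
      (blockBuyers n j x ω.2).card + a ≤ (blockItems n j ω.1).card} := by
  refine measurableSet_le (f := fun ω : (Fin m → ℕ) × (ℕ → ℝ≥0) => (blockBuyers n j x ω.2).card + a)
    (g := fun ω : (Fin m → ℕ) × (ℕ → ℝ≥0) => (blockItems n j ω.1).card) ?_ ?_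
  · refine Measurable.add_const ?_ _
    simp only [blockBuyers, Finset.card_filter]
    refine Finset.measurable_fun_sum _ fun t _ =>
      Measurable.ite ?_ measurable_const measurable_const
    exact measurableSet_le measurable_const ((measurable_pi_apply t).comp measurable_snd)
  · exact (Measurable.of_discrete (f := fun H : Fin m → ℕ => (blockItems n j H).card)).comp
      measurable_fst

lemma measurable_blockTerm {m : ℕ} (n j t : ℕ) (x : ℝ≥0) :
    Measurable fun ω : (Fin m → ℕ) × (ℕ → ℝ≥0) =>
      Set.indicator {ω : (Fin m → ℕ) × (ℕ → ℝ≥0) |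
        (blockBuyers n j x ω.2).card + 0 ≤ (blockItems n j ω.1).card}
        (1 : (Fin m → ℕ) × (ℕ → ℝ≥0) → ℝ≥0∞) ω *
      Set.indicator {y : ℝ≥0 | x ≤ y} (fun y => (y : ℝ≥0∞)) (ω.2 t) := by
  have hind : Measurable (Set.indicator {y : ℝ≥0 | x ≤ y} (fun y => (y : ℝ≥0∞))) :=
    Measurable.indicator (by fun_prop) (measurableSet_le measurable_const measurable_id)
  exact (measurable_one.indicator (measurableSet_blockBuyers_card_add_le n j 0 x)).mul
    (hind.comp ((measurable_pi_apply t).comp measurable_snd))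

/-- The valuation of a single buyer is nearly independent of the event that a block has no more high
valuations than there are items for it: drawing the valuation afresh changes the number of high
valuations by at most one. -/
lemma lintegral_blockBuyer_ge (I : GeometricInstance) (m n j t : ℕ) (x : ℝ≥0) :
    (∫⁻ y in {y : ℝ≥0 | x ≤ y}, (y : ℝ≥0∞) ∂I.valuation) *
      I.law m {ω | (blockBuyers n j x ω.2).card + 1 ≤ (blockItems n j ω.1).card} ≤
    ∫⁻ ω, Set.indicator {ω : (Fin m → ℕ) × (ℕ → ℝ≥0) |
        (blockBuyers n j x ω.2).card + 0 ≤ (blockItems n j ω.1).card} 1 ω *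
      Set.indicator {y : ℝ≥0 | x ≤ y} (fun y => (y : ℝ≥0∞)) (ω.2 t) ∂I.law m := by
  have hy : MeasurableSet {y : ℝ≥0 | x ≤ y} := measurableSet_le measurable_const measurable_id
  have hind : Measurable (Set.indicator {y : ℝ≥0 | x ≤ y} (fun y => (y : ℝ≥0∞))) :=
    Measurable.indicator (by fun_prop) hy
  have hE1 := measurableSet_blockBuyers_card_add_le (m := m) n j 1 x
  rw [← (I.measurePreserving_update_valuation m t).lintegral_comp (measurable_blockTerm n j t x)]
  calc _ = ∫⁻ z, Set.indicator {ω : (Fin m → ℕ) × (ℕ → ℝ≥0) |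
        (blockBuyers n j x ω.2).card + 1 ≤ (blockItems n j ω.1).card} 1 z.1 *
      Set.indicator {y : ℝ≥0 | x ≤ y} (fun y => (y : ℝ≥0∞)) z.2 ∂(I.law m).prod I.valuation := by
        rw [lintegral_prod_mul (f := Set.indicator {ω : (Fin m → ℕ) × (ℕ → ℝ≥0) |
          (blockBuyers n j x ω.2).card + 1 ≤ (blockItems n j ω.1).card} 1)
          (measurable_one.indicator hE1).aemeasurable hind.aemeasurable,
          lintegral_indicator_one hE1, lintegral_indicator hy, mul_comm]
    _ ≤ _ := by
        refine lintegral_mono fun z => ?_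
        obtain ⟨⟨H, X⟩, y⟩ := z
        simp only [Function.update_self]
        gcongr
        simp only [Set.indicator_apply]
        by_cases h : (blockBuyers n j x X).card + 1 ≤ (blockItems n j H).card
        · have hsub : blockBuyers n j x (Function.update X t y) ⊆
              insert t (blockBuyers n j x X) := by
            intro s hs
            by_cases hst : s = t
            · simp [hst]
            · refine Finset.mem_insert_of_mem ?_
              simpa [blockBuyers, hst] using hs
          have h2 := (Finset.card_le_card hsub).trans (Finset.card_insert_le _ _)
          have h3 : (blockBuyers n j x (Function.update X t y)).card + 0 ≤
            (blockItems n j H).card := by omega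
          rw [if_pos (show (H, X) ∈ {ω : (Fin m → ℕ) × (ℕ → ℝ≥0) |
            (blockBuyers n j x ω.2).card + 1 ≤ (blockItems n j ω.1).card} from h),
            if_pos (show (H, Function.update X t y) ∈ {ω : (Fin m → ℕ) × (ℕ → ℝ≥0) |
            (blockBuyers n j x ω.2).card + 0 ≤ (blockItems n j ω.1).card} from h3)]
          rfl
        · rw [if_neg (show (H, X) ∉ {ω : (Fin m → ℕ) × (ℕ → ℝ≥0) |
            (blockBuyers n j x ω.2).card + 1 ≤ (blockItems n j ω.1).card} from h)]
          exact zero_le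

/-- With high probability, fewer buyers of a block pass the threshold than there are items that
depart in the next block. Here `M` is the expected number of these items. -/
lemma law_blockBuyers_lt_ge (I : GeometricInstance) (m n j : ℕ) (x : ℝ≥0) {η M : ℝ} (hη : 0 < η)
    (hM : M = m * ((1 - I.rate : ℝ) ^ ((j + 1) * n) - (1 - I.rate : ℝ) ^ ((j + 2) * n)))
    (hq : n * I.valuation.real {y | x ≤ y} ≤ (1 - η) * M) (hηM : 4 ≤ η * M) :
    ENNReal.ofReal (1 - 20 / (η ^ 2 * M)) ≤
      I.law m {ω | (blockBuyers n j x ω.2).card + 1 ≤ (blockItems n j ω.1).card} := by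
  classical
  have hMpos : 0 < M := by
    by_contra h
    have : η * M ≤ 0 := mul_nonpos_of_nonneg_of_nonpos hη.le (not_lt.1 h)
    linarith
  have hy : MeasurableSet {y : ℝ≥0 | x ≤ y} := measurableSet_le measurable_const measurable_id
  have h1 := measure_card_filter_deviation_le I.valuation (Finset.Ico (j * n) ((j + 1) * n)) hy
    (d := η * M / 4) (by positivity)
  have h2 := measure_card_filter_deviation_le I.horizon (Finset.univ : Finset (Fin m))
    (A := Set.Ioc ((j + 1) * n) ((j + 2) * n)) measurableSet_Ioc (d := η * M / 2) (by positivity)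
  rw [Measure.infinitePi_eq_pi, I.horizon_Ioc _ _ (Nat.mul_le_mul_right _ (by omega)),
    Finset.card_univ, Fintype.card_fin, ← hM] at h2
  have hcard : (Finset.Ico (j * n) ((j + 1) * n)).card = n := by
    rw [Nat.card_Ico, Nat.succ_mul]; omega
  rw [hcard] at h1
  set bad1 := {Y : ℕ → ℝ≥0 | η * M / 4 ≤ |(((Finset.Ico (j * n) ((j + 1) * n)).filter
    fun i => Y i ∈ {y : ℝ≥0 | x ≤ y}).card : ℝ) - n * I.valuation.real {y | x ≤ y}|}
  set bad2 := {Y : Fin m → ℕ | η * M / 2 ≤ |(((Finset.univ : Finset (Fin m)).filter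
    fun i => Y i ∈ Set.Ioc ((j + 1) * n) ((j + 2) * n)).card : ℝ) - M|}
  set good := {ω : (Fin m → ℕ) × (ℕ → ℝ≥0) |
    (blockBuyers n j x ω.2).card + 1 ≤ (blockItems n j ω.1).card}
  have hcompl : goodᶜ ⊆ (Set.univ ×ˢ bad1) ∪ (bad2 ×ˢ Set.univ) := by
    rintro ⟨H, X⟩ hbad
    by_contra hc
    simp only [Set.mem_union, Set.mem_prod, Set.mem_univ, true_and, and_true, not_or] at hc
    apply hbad
    obtain ⟨hb1, hb2⟩ := hc
    have hb1' : |((blockBuyers n j x X).card : ℝ) - n * I.valuation.real {y | x ≤ y}| <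
      η * M / 4 := lt_of_not_ge hb1
    have hb2' : |((blockItems n j H).card : ℝ) - M| < η * M / 2 := by
      have e2 : (Finset.univ : Finset (Fin m)).filter
          (fun i => H i ∈ Set.Ioc ((j + 1) * n) ((j + 2) * n)) = blockItems n j H := by
        ext i; simp [blockItems]
      rw [← e2]
      exact lt_of_not_ge hb2
    rw [abs_lt] at hb1' hb2'
    have h3 : ((blockBuyers n j x X).card : ℝ) + 1 ≤ (blockItems n j H).card := by
      nlinarith [hb1'.2, hb2'.1]
    change (blockBuyers n j x X).card + 1 ≤ (blockItems n j H).card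
    exact_mod_cast h3
  have hprob : I.law m goodᶜ ≤ ENNReal.ofReal (20 / (η ^ 2 * M)) := by
    calc I.law m goodᶜ ≤ I.law m (Set.univ ×ˢ bad1) + I.law m (bad2 ×ˢ Set.univ) :=
          (measure_mono hcompl).trans (measure_union_le _ _)
      _ = Measure.infinitePi (fun _ : ℕ => I.valuation) bad1 +
          Measure.pi (fun _ : Fin m => I.horizon) bad2 := by
          rw [GeometricInstance.law, Measure.prod_prod, Measure.prod_prod, measure_univ,
            measure_univ, one_mul, mul_one]
      _ ≤ ENNReal.ofReal (16 / (η ^ 2 * M)) + ENNReal.ofReal (4 / (η ^ 2 * M)) := by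
          gcongr
          · refine h1.trans (ENNReal.ofReal_le_ofReal ?_)
            rw [div_le_div_iff₀ (by positivity) (by positivity)]
            have : n * I.valuation.real {y | x ≤ y} ≤ M := by nlinarith
            calc _ ≤ M * (η ^ 2 * M) := by gcongr
              _ = _ := by ring
          · refine h2.trans (ENNReal.ofReal_le_ofReal (le_of_eq ?_))
            field_simp; norm_num
      _ = _ := by
          rw [← ENNReal.ofReal_add (by positivity) (by positivity)]
          congr 1; ring
  have hgm : MeasurableSet good := measurableSet_blockBuyers_card_add_le n j 1 x
  rw [ENNReal.ofReal_sub _ (by positivity), ENNReal.ofReal_one, tsub_le_iff_right,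
    ← prob_add_prob_compl (μ := I.law m) hgm]
  gcongr

/-- The prophet can serve the high valuations of each block of `n` buyers by the items that depart
during the next block. -/
theorem prophet_ge_sum_blocks (I : GeometricInstance) (m n J : ℕ) (x : ℕ → ℝ≥0) {η : ℝ} (hη : 0 < η)
    (M : ℕ → ℝ)
    (hM : ∀ j, M j = m * ((1 - I.rate : ℝ) ^ ((j + 1) * n) - (1 - I.rate : ℝ) ^ ((j + 2) * n)))
    (hq : ∀ j < J, n * I.valuation.real {y | x j ≤ y} ≤ (1 - η) * M j)
    (hηM : ∀ j < J, 4 ≤ η * M j) :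
    ∑ j ∈ Finset.range J, n * (∫⁻ y in {y : ℝ≥0 | x j ≤ y}, (y : ℝ≥0∞) ∂I.valuation) *
      ENNReal.ofReal (1 - 20 / (η ^ 2 * M j)) ≤ I.prophet m := by
  classical
  have hy : ∀ j, MeasurableSet {y : ℝ≥0 | x j ≤ y} := fun j =>
    measurableSet_le measurable_const measurable_id
  have hfm : ∀ j t, Measurable fun ω : (Fin m → ℕ) × (ℕ → ℝ≥0) =>
      Set.indicator {ω : (Fin m → ℕ) × (ℕ → ℝ≥0) |
        (blockBuyers n j (x j) ω.2).card + 0 ≤ (blockItems n j ω.1).card}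
        (1 : (Fin m → ℕ) × (ℕ → ℝ≥0) → ℝ≥0∞) ω *
      Set.indicator {y : ℝ≥0 | x j ≤ y} (fun y => (y : ℝ≥0∞)) (ω.2 t) :=
    fun j t => measurable_blockTerm n j t (x j)
  calc _ ≤ ∑ j ∈ Finset.range J, ∑ t ∈ Finset.Ico (j * n) ((j + 1) * n),
        ∫⁻ ω, Set.indicator {ω : (Fin m → ℕ) × (ℕ → ℝ≥0) |
        (blockBuyers n j (x j) ω.2).card + 0 ≤ (blockItems n j ω.1).card} 1 ω *
      Set.indicator {y : ℝ≥0 | x j ≤ y} (fun y => (y : ℝ≥0∞)) (ω.2 t) ∂I.law m := by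
        refine Finset.sum_le_sum fun j hj => ?_
        have hj := Finset.mem_range.1 hj
        have h1 := law_blockBuyers_lt_ge I m n j (x j) hη (hM j) (hq j hj) (hηM j hj)
        calc _ = ∑ t ∈ Finset.Ico (j * n) ((j + 1) * n),
              (∫⁻ y in {y : ℝ≥0 | x j ≤ y}, (y : ℝ≥0∞) ∂I.valuation) *
                ENNReal.ofReal (1 - 20 / (η ^ 2 * M j)) := by
              rw [Finset.sum_const, Nat.card_Ico, Nat.succ_mul, Nat.add_sub_cancel_left,
                nsmul_eq_mul, mul_assoc]
          _ ≤ _ := Finset.sum_le_sum fun t _ => le_trans (by gcongr)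
              (lintegral_blockBuyer_ge I m n j t (x j))
    _ = ∫⁻ ω, ∑ j ∈ Finset.range J, ∑ t ∈ Finset.Ico (j * n) ((j + 1) * n),
        Set.indicator {ω : (Fin m → ℕ) × (ℕ → ℝ≥0) |
        (blockBuyers n j (x j) ω.2).card + 0 ≤ (blockItems n j ω.1).card} 1 ω *
      Set.indicator {y : ℝ≥0 | x j ≤ y} (fun y => (y : ℝ≥0∞)) (ω.2 t) ∂I.law m := by
        rw [lintegral_finsetSum _ fun j _ => Finset.measurable_fun_sum _ fun t _ => hfm j t]
        exact Finset.sum_congr rfl fun j _ => (lintegral_finsetSum _ fun t _ => hfm j t).symm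
    _ ≤ I.prophet m := by
        refine lintegral_mono fun ω => le_trans (le_of_eq ?_)
          (sum_blocks_le_prophetWelfare n J x ω.1 ω.2)
        refine Finset.sum_congr rfl fun j _ => ?_
        rw [← Finset.mul_sum]
        simp only [Set.indicator_apply, add_zero]
        rw [← Finset.sum_filter]
        by_cases h : (blockBuyers n j (x j) ω.2).card ≤ (blockItems n j ω.1).card
        · rw [if_pos h, if_pos (by exact h)]
          simp [blockBuyers]
        · rw [if_neg h, if_neg (by exact h), zero_mul]

/-! ### The first departure -/

/-- The largest of the first `h` valuations. -/
noncomputable def firstMax (h : ℕ) (X : ℕ → ℝ≥0) : ℝ≥0 := (Finset.range h).sup X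

/-- If item `i` is the first to depart, after `a + 1` buyers, then it can be sold to the best of
these buyers, and the other items to the later ones. -/
lemma firstMax_add_prophetWelfare_le {m : ℕ} (i : Fin (m + 1)) (a : ℕ) (N : Fin m → ℕ)
    (X : ℕ → ℝ≥0) :
    (firstMax (a + 1) X : ℝ≥0∞) + prophetWelfare (fun j => N j + 1) (fun t => X (t + (a + 1))) ≤
      prophetWelfare
        (fun j => i.insertNth (α := fun _ => ℕ) a (fun k => N k + (a + 1)) j + 1) X := by
  obtain ⟨t₀, ht₀, he⟩ := Finset.exists_mem_eq_sup (Finset.range (a + 1)) (by simp) X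
  have ht₀ := Finset.mem_range.1 ht₀
  rw [firstMax, he]
  have hne : ∃ M, IsMatching (fun j => N j + 1) M := ⟨fun _ => none, by simp, by simp⟩
  unfold prophetWelfare
  rw [ENNReal.add_biSup' (p := IsMatching fun j => N j + 1) hne]
  refine iSup₂_le fun M hM => ?_
  refine le_trans ?_ (le_iSup₂_of_le (i.insertNth (α := fun _ => Option ℕ) (some t₀)
    (fun k => (M k).map (· + (a + 1)))) ?_ le_rfl)
  · unfold matchingWelfare
    rw [Fin.sum_univ_succAbove _ i]
    simp only [Fin.insertNth_apply_same, Fin.insertNth_apply_succAbove]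
    refine add_le_add le_rfl (Finset.sum_le_sum fun k _ => ?_)
    cases M k <;> simp
  · refine ⟨fun j k t => ?_, fun j t => ?_⟩
    · induction j using i.succAboveCases with
      | x =>
        induction k using i.succAboveCases with
        | x => simp
        | p k =>
          simp only [Fin.insertNth_apply_same, Fin.insertNth_apply_succAbove, Option.some.injEq,
            Option.map_eq_some_iff]
          rintro rfl ⟨s, _, h⟩
          omega
      | p j =>
        induction k using i.succAboveCases with
        | x =>
          simp only [Fin.insertNth_apply_same, Fin.insertNth_apply_succAbove, Option.some.injEq,
            Option.map_eq_some_iff]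
          rintro ⟨s, _, h⟩ rfl
          omega
        | p k =>
          simp only [Fin.insertNth_apply_succAbove, Option.map_eq_some_iff]
          rintro ⟨s, hs, rfl⟩ ⟨s', hs', h⟩
          obtain rfl : s' = s := by omega
          rw [hM.1 j k s' hs hs']
    · induction j using i.succAboveCases with
      | x =>
        simp only [Fin.insertNth_apply_same, Option.some.injEq]
        rintro rfl; exact ht₀
      | p j =>
        simp only [Fin.insertNth_apply_succAbove, Option.map_eq_some_iff]
        rintro ⟨s, hs, rfl⟩
        have : s < N j + 1 := hM.2 j s hs
        omega

lemma measurable_prophetWelfare {m : ℕ} :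
    Measurable fun ω : (Fin m → ℕ) × (ℕ → ℝ≥0) => prophetWelfare ω.1 ω.2 := by
  refine measurable_from_prod_countable_right fun H => ?_
  unfold prophetWelfare matchingWelfare
  refine Measurable.iSup fun M => ?_
  change Measurable fun X : ℕ → ℝ≥0 =>
    ⨆ (_ : IsMatching H M), ∑ i, (M i).elim 0 fun t => (X t : ℝ≥0∞)
  refine Measurable.iSup_Prop _ ?_
  refine Finset.measurable_fun_sum _ fun i _ => ?_
  cases M i with
  | none => simp
  | some t => simpa using (measurable_pi_apply t).coe_nnreal_ennreal

namespace GeometricInstance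

variable (I : GeometricInstance)

/-- The expected welfare of the prophet when item `j` departs right after buyer `N j`, so that its
horizon is `N j + 1`. -/
noncomputable def prophetGiven {m : ℕ} (N : Fin m → ℕ) : ℝ≥0∞ :=
  ∫⁻ X, prophetWelfare (fun j => N j + 1) X ∂Measure.infinitePi fun _ : ℕ => I.valuation

lemma prophet_eq_tsum (m : ℕ) :
    I.prophet m = ∑' N : Fin m → ℕ, I.prophetGiven N * ∏ j, (I.surv ^ N j * I.dep) := by
  have h : MeasurePreserving (fun (N : Fin m → ℕ) j => N j + 1)
      (Measure.pi fun _ => geometricMeasure I.rate) (Measure.pi fun _ : Fin m => I.horizon) :=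
    measurePreserving_pi (fun _ : Fin m => geometricMeasure I.rate) (fun _ => I.horizon)
      (f := fun _ n => n + 1) fun _ => ⟨by fun_prop, rfl⟩
  rw [prophet, law, lintegral_prod _ measurable_prophetWelfare.aemeasurable,
    ← h.lintegral_comp (f := fun H => ∫⁻ X, prophetWelfare H X
      ∂Measure.infinitePi fun _ : ℕ => I.valuation) Measurable.of_discrete,
    lintegral_countable']
  refine tsum_congr fun N => ?_
  rw [Measure.pi_singleton]
  simp_rw [I.geometric_singleton]
  rfl

lemma tsum_prod_geometric (m : ℕ) :
    ∑' N : Fin m → ℕ, ∏ j, (I.surv ^ N j * I.dep) = 1 := by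
  have h := lintegral_countable' (μ := Measure.pi fun _ : Fin m => geometricMeasure I.rate)
    (fun _ => (1 : ℝ≥0∞))
  simp only [lintegral_const, measure_univ, one_mul, Measure.pi_singleton,
    I.geometric_singleton] at h
  exact h.symm

lemma lintegral_firstMax_add_prophetGiven_le {m : ℕ} (i : Fin (m + 1)) (a : ℕ) (N : Fin m → ℕ) :
    ∫⁻ X, (firstMax (a + 1) X : ℝ≥0∞) ∂(Measure.infinitePi fun _ : ℕ => I.valuation) +
      I.prophetGiven N ≤
      I.prophetGiven (i.insertNth (α := fun _ => ℕ) a (fun k => N k + (a + 1))) := by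
  have hm : Measurable fun X : ℕ → ℝ≥0 => prophetWelfare (fun j => N j + 1) X :=
    measurable_prophetWelfare.comp measurable_prodMk_left
  have hshift : MeasurePreserving (fun (X : ℕ → ℝ≥0) t => X (t + (a + 1)))
      (Measure.infinitePi fun _ : ℕ => I.valuation) (Measure.infinitePi fun _ : ℕ => I.valuation) :=
    ⟨by fun_prop, Measure.map_infinitePi_infinitePi_of_inj (P := fun _ : ℕ => I.valuation)
      (f := fun t => t + (a + 1)) (add_left_injective _)⟩
  have hm2 : Measurable fun X : ℕ → ℝ≥0 =>
      prophetWelfare (fun j => N j + 1) fun t => X (t + (a + 1)) := hm.comp hshift.measurable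
  rw [prophetGiven, ← hshift.lintegral_comp hm, ← lintegral_add_right _ hm2]
  exact lintegral_mono fun X => firstMax_add_prophetWelfare_le i a N X

/-- Condition on a unique first departure: it leaves behind an instance with one item less. -/
lemma prophet_succ_ge_tsum (m : ℕ) :
    ∑' a : ℕ, (m + 1 : ℕ) * (I.dep * I.surv ^ m * (I.surv ^ (m + 1)) ^ a) *
      (∫⁻ X, (firstMax (a + 1) X : ℝ≥0∞) ∂(Measure.infinitePi fun _ : ℕ => I.valuation) +
        I.prophet m) ≤ I.prophet (m + 1) := by
  set Φ : Fin (m + 1) × ℕ × (Fin m → ℕ) → Fin (m + 1) → ℕ := fun x =>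
    x.1.insertNth (α := fun _ => ℕ) x.2.1 (fun k => x.2.2 k + (x.2.1 + 1)) with hΦ
  -- In `Φ (i, a, N)`, item `i` is the only first item to depart, so that `(i, a, N)` is determined.
  -- Configurations outside the range of `Φ`, with several first departures, are dropped.
  have hinj : Function.Injective Φ := by
    rintro ⟨i, a, N⟩ ⟨i', a', N'⟩ h
    have hmin : ∀ (i : Fin (m + 1)) (a : ℕ) (N : Fin m → ℕ) (j : Fin (m + 1)), j ≠ i →
        a < Φ (i, a, N) j := by
      intro i a N j hj
      obtain ⟨k, rfl⟩ := Fin.exists_succAbove_eq hj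
      simp only [hΦ, Fin.insertNth_apply_succAbove]; omega
    have hi : Φ (i, a, N) i = a := by simp [hΦ]
    have hi' : Φ (i', a', N') i' = a' := by simp [hΦ]
    have hii : i = i' := by
      by_contra hne
      have h1 := hmin i a N i' (Ne.symm hne)
      have h2 := hmin i' a' N' i hne
      rw [h, hi'] at h1
      rw [← h, hi] at h2
      omega
    subst hii
    have haa : a = a' := by rw [← hi, h, hi']
    subst haa
    congr 2
    funext k
    have := congrFun h (i.succAbove k)
    simp only [hΦ, Fin.insertNth_apply_succAbove] at this
    omega
  rw [I.prophet_eq_tsum (m + 1)]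
  refine le_trans ?_ (ENNReal.tsum_comp_le_tsum_of_injective hinj _)
  conv_rhs => rw [ENNReal.tsum_prod', tsum_fintype]
  conv_rhs => enter [2, i]; rw [ENNReal.tsum_prod']
  calc _ = ∑ i : Fin (m + 1), ∑' a : ℕ, ∑' N : Fin m → ℕ,
        (∫⁻ X, (firstMax (a + 1) X : ℝ≥0∞) ∂(Measure.infinitePi fun _ : ℕ => I.valuation) +
        I.prophetGiven N) *
        ((I.dep * I.surv ^ m * (I.surv ^ (m + 1)) ^ a) * ∏ j, (I.surv ^ N j * I.dep)) := by
        rw [Finset.sum_const, Finset.card_univ, Fintype.card_fin, nsmul_eq_mul,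
          ← ENNReal.tsum_mul_left]
        refine tsum_congr fun a => ?_
        rw [mul_assoc]
        congr 1
        rw [I.prophet_eq_tsum m]
        simp_rw [add_mul]
        rw [ENNReal.tsum_add, ENNReal.tsum_mul_left, ENNReal.tsum_mul_left, I.tsum_prod_geometric,
          mul_one, mul_add, ← ENNReal.tsum_mul_left, mul_comm]
        congr 1
        exact tsum_congr fun N => by ring
    _ ≤ _ := by
        refine Finset.sum_le_sum fun i _ => ENNReal.tsum_le_tsum fun a =>
          ENNReal.tsum_le_tsum fun N => ?_
        refine mul_le_mul' (I.lintegral_firstMax_add_prophetGiven_le i a N) (le_of_eq ?_)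
        rw [Fin.prod_univ_succAbove _ i]
        simp only [hΦ, Fin.insertNth_apply_same, Fin.insertNth_apply_succAbove]
        simp_rw [pow_add _ _ (a + 1), mul_right_comm _ (I.surv ^ (a + 1))]
        rw [Finset.prod_mul_distrib (f := fun j => I.surv ^ N j * I.dep), Finset.prod_const,
          Finset.card_univ, Fintype.card_fin]
        ring

lemma measure_lt_firstMax (h : ℕ) {x : ℝ} (hx : 0 < x) :
    Measure.infinitePi (fun _ : ℕ => I.valuation) {X | x < firstMax h X} =
      ENNReal.ofReal (1 - (1 - I.valuation.real {y | x < y}) ^ h) := by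
  have hy : MeasurableSet {y : ℝ≥0 | x < y} := measurableSet_lt measurable_const (by fun_prop)
  have hset : {X : ℕ → ℝ≥0 | x < firstMax h X}ᶜ =
      Set.pi (Finset.range h : Finset ℕ) fun _ => {y : ℝ≥0 | x < y}ᶜ := by
    ext X
    simp only [Set.mem_compl_iff, Set.mem_ofPred_eq, not_lt, Set.mem_pi, Finset.mem_coe]
    rw [← Real.le_toNNReal_iff_coe_le hx.le, firstMax, Finset.sup_le_iff]
    exact forall₂_congr fun t _ => Real.le_toNNReal_iff_coe_le hx.le
  have hmeas : MeasurableSet {X : ℕ → ℝ≥0 | x < firstMax h X} := by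
    rw [← MeasurableSet.compl_iff, hset]
    exact MeasurableSet.pi (Finset.countable_toSet _) fun _ _ => hy.compl
  rw [← ofReal_measureReal]
  congr 1
  rw [← compl_compl {X : ℕ → ℝ≥0 | x < firstMax h X}, probReal_compl_eq_one_sub hmeas.compl, hset,
    measureReal_def, Measure.infinitePi_pi _ fun _ _ => hy.compl]
  simp [ENNReal.toReal_pow, ← measureReal_def, probReal_compl_eq_one_sub hy]

lemma lintegral_firstMax (h : ℕ) :
    ∫⁻ X, (firstMax h X : ℝ≥0∞) ∂(Measure.infinitePi fun _ : ℕ => I.valuation) =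
      ∫⁻ x : ℝ in Set.Ioi 0, ENNReal.ofReal (1 - (1 - I.valuation.real {y | x < y}) ^ h) := by
  have hm : Measurable fun X : ℕ → ℝ≥0 => ((firstMax h X : ℝ≥0) : ℝ) := by
    have : Measurable fun X : ℕ → ℝ≥0 => firstMax h X := by
      induction h with
      | zero => simp [firstMax]
      | succ h ih =>
        simp only [firstMax, Finset.range_add_one, Finset.sup_insert]
        exact (measurable_pi_apply h).sup ih
    fun_prop
  have h1 := lintegral_eq_lintegral_meas_lt (Measure.infinitePi fun _ : ℕ => I.valuation)
    (f := fun X => ((firstMax h X : ℝ≥0) : ℝ))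
    (Filter.Eventually.of_forall fun X => NNReal.coe_nonneg _)
    hm.aemeasurable
  simp only [ENNReal.ofReal_coe_nnreal] at h1
  rw [h1]
  exact setLIntegral_congr_fun measurableSet_Ioi fun x hx => I.measure_lt_firstMax h hx

end GeometricInstance

/-! ### A recursion for the prophet -/

/-- The sum over `a` of `ρ ^ a` times the probability that one of `a + 1` independent events of
probability `s` occurs. -/
lemma hasSum_pow_mul_one_sub_pow {ρ s : ℝ} (hρ0 : 0 ≤ ρ) (hρ1 : ρ < 1) (hs0 : 0 ≤ s) (hs1 : s ≤ 1) :
    HasSum (fun a : ℕ => ρ ^ a * (1 - (1 - s) ^ (a + 1))) (s / ((1 - ρ) * (1 - ρ + ρ * s))) := by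
  have h1 := hasSum_geometric_of_lt_one hρ0 hρ1
  have hlt : ρ * (1 - s) < 1 := by nlinarith
  have h2 := (hasSum_geometric_of_lt_one (mul_nonneg hρ0 (by linarith : 0 ≤ 1 - s))
    hlt).mul_left (1 - s)
  have h3 := h1.sub h2
  have hne1 : 1 - ρ ≠ 0 := by linarith
  have hne2 : 1 - ρ + ρ * s ≠ 0 := by nlinarith
  have e1 : (fun a : ℕ => ρ ^ a * (1 - (1 - s) ^ (a + 1))) =
      fun a => ρ ^ a - (1 - s) * (ρ * (1 - s)) ^ a := by
    funext a
    rw [mul_pow]; ring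
  have e2 : s / ((1 - ρ) * (1 - ρ + ρ * s)) = (1 - ρ)⁻¹ - (1 - s) * (1 - ρ * (1 - s))⁻¹ := by
    rw [show 1 - ρ * (1 - s) = 1 - ρ + ρ * s by ring, div_eq_iff (mul_ne_zero hne1 hne2)]
    linear_combination (-(1 - ρ + ρ * s)) * inv_mul_cancel₀ hne1 +
      (1 - s) * (1 - ρ) * inv_mul_cancel₀ hne2
  rw [e1, e2]
  exact h3

namespace GeometricInstance

variable (I : GeometricInstance)

lemma one_sub_rate_pow_ge (k : ℕ) : 1 - k * (I.rate : ℝ) ≤ (1 - I.rate : ℝ) ^ k := by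
  have h := I.rate.2
  have := one_add_mul_le_pow (a := -(I.rate : ℝ)) (by linarith [h.2]) k
  calc _ = 1 + k * (-(I.rate : ℝ)) := by ring
    _ ≤ _ := this
    _ = _ := by ring

lemma rate_pos : 0 < (I.rate : ℝ) :=
  lt_of_le_of_ne I.rate.2.1 fun h => I.rate_ne_zero (Subtype.ext h.symm)

/-- Lower bound on the welfare of the prophet by induction on the number of items: with probability
at least `(1 - rate) ^ m` a single item departs first, and it can be sold to the best buyer that it
sees. -/
lemma prophet_succ_ge (m : ℕ) :
    I.surv ^ m * ((∫⁻ x : ℝ in Set.Ioi 0, ENNReal.ofReal (I.valuation.real {y | x < y} /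
        ((m + 1) * I.rate + I.valuation.real {y | x < y}))) + I.prophet m) ≤ I.prophet (m + 1) := by
  refine le_trans ?_ (I.prophet_succ_ge_tsum m)
  have hr0 := I.rate_pos
  have hr1 : (I.rate : ℝ) ≤ 1 := I.rate.2.2
  set s : ℝ → ℝ := fun x => I.valuation.real {y | x < y} with hs
  have hs0 : ∀ x, 0 ≤ s x := fun x => measureReal_nonneg
  have hs1 : ∀ x, s x ≤ 1 := fun x => measureReal_le_one
  have hsanti : Antitone s := fun a b hab =>
    measureReal_mono fun y (hy : b < y) => lt_of_le_of_lt hab hy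
  set ρ : ℝ := (1 - I.rate : ℝ) ^ (m + 1) with hρ
  have hρ0 : 0 ≤ ρ := pow_nonneg (by linarith) _
  have hρ1 : ρ < 1 := pow_lt_one₀ (by linarith) (by linarith) (by omega)
  have hρle : 1 - ρ ≤ (m + 1) * I.rate := by
    have := I.one_sub_rate_pow_ge (m + 1)
    push_cast at this
    linarith
  have hρE : I.surv ^ (m + 1) = ENNReal.ofReal ρ := by
    rw [surv, hρ, ENNReal.ofReal_pow (by linarith)]
  have hcoef : 1 ≤ ((m + 1 : ℕ) : ℝ≥0∞) * I.dep * ENNReal.ofReal ((1 - ρ)⁻¹) := by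
    rw [dep, ← ENNReal.ofReal_natCast, ← ENNReal.ofReal_mul (by positivity),
      ← ENNReal.ofReal_mul (by positivity), ENNReal.one_le_ofReal]
    rw [← div_eq_mul_inv, one_le_div (by linarith)]
    push_cast; exact hρle
  have hgeom : ∑' a : ℕ, ENNReal.ofReal ρ ^ a = ENNReal.ofReal ((1 - ρ)⁻¹) := by
    rw [ENNReal.tsum_geometric, ENNReal.ofReal_inv_of_pos (by linarith),
      ENNReal.ofReal_sub _ hρ0, ENNReal.ofReal_one]
  have hmax : ∑' a : ℕ, ENNReal.ofReal ρ ^ a *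
      ∫⁻ X, (firstMax (a + 1) X : ℝ≥0∞) ∂(Measure.infinitePi fun _ : ℕ => I.valuation) =
      ∫⁻ x : ℝ in Set.Ioi 0, ENNReal.ofReal (s x / ((1 - ρ) * (1 - ρ + ρ * s x))) := by
    simp_rw [I.lintegral_firstMax]
    have hmeas : ∀ a : ℕ, Measurable fun x : ℝ =>
        ENNReal.ofReal (1 - (1 - I.valuation.real {y | x < y}) ^ (a + 1)) := by
      intro a
      have : Measurable s := hsanti.measurable
      exact ((measurable_const.sub ((measurable_const.sub this).pow_const _))).ennreal_ofReal
    simp_rw [← lintegral_const_mul _ (hmeas _)]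
    rw [← lintegral_tsum fun a => ((hmeas a).const_mul _).aemeasurable]
    refine lintegral_congr fun x => ?_
    have h := hasSum_pow_mul_one_sub_pow hρ0 hρ1 (hs0 x) (hs1 x)
    rw [← h.tsum_eq, ENNReal.ofReal_tsum_of_nonneg _ h.summable]
    · refine tsum_congr fun a => ?_
      rw [ENNReal.ofReal_mul (by positivity), ENNReal.ofReal_pow hρ0]
    · intro a
      have : (1 - s x) ^ (a + 1) ≤ 1 := pow_le_one₀ (by linarith [hs1 x]) (by linarith [hs0 x])
      exact mul_nonneg (by positivity) (by linarith)
  have hint : ∫⁻ x : ℝ in Set.Ioi 0, ENNReal.ofReal (s x / ((1 - ρ) * (1 - ρ + ρ * s x))) ≥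
      ENNReal.ofReal ((1 - ρ)⁻¹) *
        ∫⁻ x : ℝ in Set.Ioi 0, ENNReal.ofReal (s x / ((m + 1) * I.rate + s x)) := by
    have : Measurable s := hsanti.measurable
    rw [← lintegral_const_mul _ (by fun_prop)]
    refine lintegral_mono fun x => ?_
    rw [← ENNReal.ofReal_mul (by rw [inv_nonneg]; linarith)]
    refine ENNReal.ofReal_le_ofReal ?_
    rw [div_mul_eq_div_div, div_right_comm, ← div_eq_inv_mul]
    refine div_le_div_of_nonneg_right ?_ (by linarith)
    refine div_le_div_of_nonneg_left (hs0 x) (by nlinarith [hs0 x]) ?_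
    nlinarith [hs0 x]
  calc I.surv ^ m * ((∫⁻ x : ℝ in Set.Ioi 0, ENNReal.ofReal (s x / ((m + 1) * I.rate + s x))) +
        I.prophet m)
      ≤ I.surv ^ m * ((∫⁻ x : ℝ in Set.Ioi 0, ENNReal.ofReal (s x / ((m + 1) * I.rate + s x))) +
        I.prophet m) *
        (((m + 1 : ℕ) : ℝ≥0∞) * I.dep * ENNReal.ofReal ((1 - ρ)⁻¹)) := le_mul_of_one_le_right' hcoef
    _ = ((m + 1 : ℕ) * (I.dep * I.surv ^ m)) *
        (ENNReal.ofReal ((1 - ρ)⁻¹) *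
          (∫⁻ x : ℝ in Set.Ioi 0, ENNReal.ofReal (s x / ((m + 1) * I.rate + s x))) +
          ENNReal.ofReal ((1 - ρ)⁻¹) * I.prophet m) := by ring
    _ ≤ ((m + 1 : ℕ) * (I.dep * I.surv ^ m)) * (∑' a : ℕ, ENNReal.ofReal ρ ^ a *
      ∫⁻ X, (firstMax (a + 1) X : ℝ≥0∞) ∂(Measure.infinitePi fun _ : ℕ => I.valuation) +
      (∑' a : ℕ, ENNReal.ofReal ρ ^ a) * I.prophet m) := by
        rw [hmax, hgeom]; gcongr
    _ = _ := by
        rw [← ENNReal.tsum_mul_right, ← ENNReal.tsum_add, ← ENNReal.tsum_mul_left, hρE]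
        refine tsum_congr fun a => ?_
        ring

end GeometricInstance

/-! ### Pareto valuations -/

/-- The Pareto law with tail `x ^ (-2)` on `[1, ∞)`. -/
noncomputable def paretoLaw : Measure ℝ≥0 := (paretoMeasure 1 2).map Real.toNNReal

instance : IsProbabilityMeasure paretoLaw :=
  have := isProbabilityMeasure_paretoMeasure (t := 1) (r := 2) one_pos two_pos
  Measure.isProbabilityMeasure_map (by fun_prop)

lemma lintegral_Ioi_rpow {c a : ℝ} (hc : 0 < c) (ha : a < -1) :
    ∫⁻ u in Set.Ioi c, ENNReal.ofReal (u ^ a) = ENNReal.ofReal (-c ^ (a + 1) / (a + 1)) := by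
  rw [← integral_Ioi_rpow_of_lt ha hc, ofReal_integral_eq_lintegral_ofReal
    (integrableOn_Ioi_rpow_of_lt ha hc)]
  filter_upwards [ae_restrict_mem measurableSet_Ioi] with u hu
  exact Real.rpow_nonneg (hc.trans hu).le _

lemma setLIntegral_paretoLaw {S : Set ℝ≥0} (hSm : MeasurableSet S) {c : ℝ} (hc : 1 ≤ c)
    (hS : ∀ u : ℝ, u ≠ c → (1 ≤ u ∧ u.toNNReal ∈ S ↔ c < u)) {g : ℝ≥0 → ℝ≥0∞} (hg : Measurable g) :
    ∫⁻ y in S, g y ∂paretoLaw =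
      ∫⁻ u in Set.Ioi c, ENNReal.ofReal (2 * u ^ (-3 : ℝ)) * g u.toNNReal := by
  classical
  have hpdf : Measurable (paretoPDF 1 2) := (measurable_paretoPDFReal 1 2).ennreal_ofReal
  have hg2 : Measurable fun u : ℝ => g u.toNNReal := hg.comp measurable_real_toNNReal
  have hpre : MeasurableSet (Real.toNNReal ⁻¹' S) := measurable_real_toNNReal hSm
  rw [paretoLaw, setLIntegral_map hSm hg measurable_real_toNNReal, paretoMeasure,
    setLIntegral_withDensity_eq_setLIntegral_mul _ hpdf hg2 hpre, ← lintegral_indicator hpre,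
    ← lintegral_indicator measurableSet_Ioi]
  have hne : ∀ᵐ u : ℝ, u ≠ c := by simp [ae_iff]
  refine lintegral_congr_ae ?_
  filter_upwards [hne] with u hu
  have h := hS u hu
  simp only [Set.indicator_apply, Set.mem_preimage, Set.mem_Ioi, Pi.mul_apply]
  by_cases h1 : 1 ≤ u
  · simp only [h1, true_and] at h
    simp only [h]
    rw [paretoPDF_of_le h1]
    norm_num
  · rw [paretoPDF_of_lt (not_le.1 h1), if_neg (show ¬ c < u by linarith [not_le.1 h1])]
    simp

lemma paretoLaw_apply {S : Set ℝ≥0} (hSm : MeasurableSet S) {c : ℝ} (hc : 1 ≤ c)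
    (hS : ∀ u : ℝ, u ≠ c → (1 ≤ u ∧ u.toNNReal ∈ S ↔ c < u)) :
    paretoLaw S = ENNReal.ofReal ((c ^ 2)⁻¹) := by
  have h := setLIntegral_paretoLaw hSm hc hS (g := fun _ => 1) measurable_const
  rw [setLIntegral_one] at h
  simp_rw [mul_one, ENNReal.ofReal_mul (zero_le_two : (0:ℝ) ≤ 2)] at h
  rw [h, lintegral_const_mul _ (by fun_prop), lintegral_Ioi_rpow (by linarith) (by norm_num),
    ← ENNReal.ofReal_mul zero_le_two]
  congr 1
  rw [show (-3 + 1 : ℝ) = -(2 : ℕ) by norm_num, Real.rpow_neg (by linarith), Real.rpow_natCast]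
  push_cast; ring

lemma setLIntegral_id_paretoLaw {S : Set ℝ≥0} (hSm : MeasurableSet S) {c : ℝ} (hc : 1 ≤ c)
    (hS : ∀ u : ℝ, u ≠ c → (1 ≤ u ∧ u.toNNReal ∈ S ↔ c < u)) :
    ∫⁻ y in S, (y : ℝ≥0∞) ∂paretoLaw = ENNReal.ofReal (2 / c) := by
  rw [setLIntegral_paretoLaw hSm hc hS (by fun_prop)]
  have : ∀ u ∈ Set.Ioi c, ENNReal.ofReal (2 * u ^ (-3 : ℝ)) * (u.toNNReal : ℝ≥0∞) =
      ENNReal.ofReal 2 * ENNReal.ofReal (u ^ (-2 : ℝ)) := by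
    intro u hu
    have hu0 : 0 < u := by have : c < u := hu; linarith
    rw [← ENNReal.ofReal_mul zero_le_two]
    change ENNReal.ofReal _ * ENNReal.ofReal u = _
    rw [← ENNReal.ofReal_mul (by positivity), mul_assoc, ← Real.rpow_add_one hu0.ne']
    norm_num
  rw [setLIntegral_congr_fun measurableSet_Ioi this, lintegral_const_mul _ (by fun_prop),
    lintegral_Ioi_rpow (by linarith) (by norm_num), ← ENNReal.ofReal_mul zero_le_two]
  congr 1
  rw [show (-2 + 1 : ℝ) = -1 by norm_num, Real.rpow_neg_one]
  ring

lemma mem_Ici_iff_of_ne (p : ℝ≥0) (u : ℝ) (hu : u ≠ max p 1) :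
    1 ≤ u ∧ u.toNNReal ∈ {y : ℝ≥0 | p ≤ y} ↔ max (p : ℝ) 1 < u := by
  simp only [Set.mem_ofPred_eq]
  constructor
  · rintro ⟨h1, h2⟩
    refine lt_of_le_of_ne (max_le ?_ h1) hu.symm
    have : (p : ℝ) ≤ u.toNNReal := h2
    rwa [Real.coe_toNNReal _ (by linarith)] at this
  · intro h
    have h1 := (le_max_right (p : ℝ) 1).trans h.le
    have h2 := (le_max_left (p : ℝ) 1).trans h.le
    exact ⟨h1, by rw [Real.le_toNNReal_iff_coe_le (by linarith)]; exact h2⟩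

lemma measurableSet_Ici_nnreal (p : ℝ≥0) : MeasurableSet {y : ℝ≥0 | p ≤ y} :=
  measurableSet_le measurable_const measurable_id

lemma paretoLaw_Ici (p : ℝ≥0) :
    paretoLaw {y | p ≤ y} = ENNReal.ofReal ((max (p : ℝ) 1 ^ 2)⁻¹) :=
  paretoLaw_apply (measurableSet_Ici_nnreal p) (le_max_right _ _) (mem_Ici_iff_of_ne p)

lemma setLIntegral_id_paretoLaw_Ici (p : ℝ≥0) :
    ∫⁻ y in {y : ℝ≥0 | p ≤ y}, (y : ℝ≥0∞) ∂paretoLaw = ENNReal.ofReal (2 / max (p : ℝ) 1) :=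
  setLIntegral_id_paretoLaw (measurableSet_Ici_nnreal p) (le_max_right _ _) (mem_Ici_iff_of_ne p)

lemma paretoLaw_real_Ioi {x : ℝ} (hx : 1 ≤ x) :
    paretoLaw.real {y : ℝ≥0 | x < y} = (x ^ 2)⁻¹ := by
  rw [measureReal_def, paretoLaw_apply (measurableSet_lt measurable_const (by fun_prop)) hx,
    ENNReal.toReal_ofReal (by positivity)]
  intro u hu
  simp only [Set.mem_ofPred_eq]
  constructor
  · rintro ⟨h1, h2⟩
    rwa [Real.coe_toNNReal _ (by linarith)] at h2
  · intro h
    exact ⟨by linarith, by rwa [Real.coe_toNNReal _ (by linarith)]⟩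

/-- The instance with Pareto valuations and departure rate `l`. -/
noncomputable def paretoInstance (l : ℝ) (h0 : 0 < l) (h1 : l ≤ 1) : GeometricInstance where
  rate := ⟨l, h0.le, h1⟩
  rate_ne_zero := fun h => h0.ne' (congrArg Subtype.val h)
  valuation := paretoLaw
  valuation_prob := inferInstance
  finite_mean := by
    have h := setLIntegral_id_paretoLaw_Ici 0
    have h2 : {y : ℝ≥0 | 0 ≤ y} = Set.univ := by ext; simp
    rw [h2, setLIntegral_univ] at h
    rw [h]; exact ENNReal.ofReal_ne_top

/-- The sum of `1 / √k` for `k = 1, …, m`. -/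
noncomputable def invSqrtSum (m : ℕ) : ℝ := ∑ k ∈ Finset.range m, 1 / √(k + 1 : ℝ)

/-- The potential `1 / √(l (1 - l) (k + 1))` of the last of `k + 1` items pays for a sale at any
price, by the inequality of arithmetic and geometric means. -/
lemma pareto_value_le {l : ℝ} (h0 : 0 < l) (h1 : l < 1) {m : ℕ} (P : PricingPolicy m) :
    P.value (paretoInstance l h0 h1.le) ≤ ENNReal.ofReal (invSqrtSum m / √(l * (1 - l))) := by
  set I := paretoInstance l h0 h1.le with hI
  set δ : ℕ → ℝ≥0∞ := fun k => ENNReal.ofReal (1 / √(k + 1 : ℝ) / √(l * (1 - l))) with hδ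
  have hδa : Antitone δ := by
    intro a b hab
    refine ENNReal.ofReal_le_ofReal ?_
    have : (a : ℝ) ≤ b := by exact_mod_cast hab
    gcongr
  have hl1 : 0 < 1 - l := by linarith
  have hsum : ENNReal.ofReal (invSqrtSum m / √(l * (1 - l))) = ∑ k ∈ Finset.range m, δ k := by
    rw [invSqrtSum, Finset.sum_div, ENNReal.ofReal_sum_of_nonneg fun _ _ => by positivity]
  rw [hsum]
  refine P.value_le I fun r => P.lintegral_welfare_le I r hδa fun k _ t past obs A => ?_
  generalize P.price t r past obs A = p
  induction p using ENNReal.recTopCoe with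
  | top => simp
  | coe p =>
    simp only [ENNReal.coe_le_coe]
    have e1 : I.dep = ENNReal.ofReal l := rfl
    have e2 : I.surv = ENNReal.ofReal (1 - l) := rfl
    have e3 : I.valuation = paretoLaw := rfl
    rw [e1, e2, e3, setLIntegral_id_paretoLaw_Ici, paretoLaw_Ici, ← ENNReal.ofReal_natCast,
      ← ENNReal.ofReal_mul (by positivity), ← ENNReal.ofReal_mul hl1.le,
      ← ENNReal.ofReal_add (by positivity) (by positivity), hδ,
      ← ENNReal.ofReal_mul (by positivity)]
    refine ENNReal.ofReal_le_ofReal ?_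
    set c := max (p : ℝ) 1
    have hc : 0 < c := lt_of_lt_of_le one_pos (le_max_right _ _)
    push_cast
    rw [div_div, mul_one_div, ← Real.sqrt_mul (by positivity), le_div_iff₀ (by positivity)]
    have hA : 0 ≤ (k + 1 : ℝ) * l := by positivity
    have h2 : √((k + 1 : ℝ) * (l * (1 - l))) = √((k + 1 : ℝ) * l) * √(1 - l) := by
      rw [← Real.sqrt_mul hA]; ring_nf
    have h3 := sq_nonneg (√((k + 1 : ℝ) * l) - √(1 - l) / c)
    have h4 := Real.sq_sqrt hA
    have h5 := Real.sq_sqrt hl1.le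
    rw [h2]
    have h6 : (√((k + 1 : ℝ) * l) - √(1 - l) / c) ^ 2 =
        (√((k + 1 : ℝ) * l)) ^ 2 + (√(1 - l)) ^ 2 * (c ^ 2)⁻¹ -
          2 / c * (√((k + 1 : ℝ) * l) * √(1 - l)) := by
      field_simp; ring
    rw [h6, h4, h5] at h3
    linarith

/-- Up to lower order terms, the expected maximum of the valuations seen while exactly `k + 1` items
are present. -/
lemma pareto_integral_ge {l : ℝ} (h0 : 0 < l) (h1 : l ≤ 1) (k : ℕ) :
    ENNReal.ofReal ((Real.pi / 2 - Real.arctan √((k + 1 : ℝ) * l)) / √((k + 1 : ℝ) * l)) ≤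
      ∫⁻ x : ℝ in Set.Ioi 0, ENNReal.ofReal
        ((paretoInstance l h0 h1).valuation.real {y | x < y} /
          ((k + 1) * (paretoInstance l h0 h1).rate +
            (paretoInstance l h0 h1).valuation.real {y | x < y})) := by
  set c : ℝ := (k + 1 : ℝ) * l with hc
  have hc0 : 0 < c := by positivity
  have hs : 0 < √c := Real.sqrt_pos.2 hc0
  have hint := integral_comp_mul_left_Ioi (fun x : ℝ => (1 + x ^ 2)⁻¹) 1 hs
  rw [mul_one, integral_Ioi_inv_one_add_sq, smul_eq_mul] at hint
  have hfin : IntegrableOn (fun x : ℝ => (1 + (√c * x) ^ 2)⁻¹) (Set.Ioi 1) :=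
    (integrable_inv_one_add_sq.comp_mul_left' hs.ne').integrableOn
  rw [div_eq_inv_mul, ← hint, ofReal_integral_eq_lintegral_ofReal hfin
    (Filter.Eventually.of_forall fun x => by positivity)]
  refine le_trans (setLIntegral_mono_ae' measurableSet_Ioi
    (Filter.Eventually.of_forall fun x hx => ?_))
    (lintegral_mono_set (Set.Ioi_subset_Ioi zero_le_one))
  refine ENNReal.ofReal_le_ofReal (le_of_eq ?_)
  have hx : (1 : ℝ) < x := hx
  have e : (paretoInstance l h0 h1).valuation.real {y | x < y} = (x ^ 2)⁻¹ :=
    paretoLaw_real_Ioi hx.le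
  have e2 : ((paretoInstance l h0 h1).rate : ℝ) = l := rfl
  rw [e, e2, ← hc, mul_pow, Real.sq_sqrt hc0.le]
  have : 0 < x := by linarith
  field_simp
  ring

lemma invSqrtSum_succ (k : ℕ) : invSqrtSum (k + 1) = invSqrtSum k + 1 / √(k + 1 : ℝ) := by
  rw [invSqrtSum, Finset.sum_range_succ]; rfl

lemma invSqrtSum_nonneg (m : ℕ) : 0 ≤ invSqrtSum m :=
  Finset.sum_nonneg fun _ _ => by positivity

lemma pareto_prophet_ge {l : ℝ} (h0 : 0 < l) (h1 : l < 1) (m k : ℕ) (hk : k ≤ m) :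
    ENNReal.ofReal (((1 - l) ^ m) ^ k * (Real.pi / 2 - Real.arctan √(m * l)) *
      (invSqrtSum k / √l)) ≤ (paretoInstance l h0 h1.le).prophet k := by
  induction k with
  | zero => simp [invSqrtSum]
  | succ k ih =>
    set I := paretoInstance l h0 h1.le
    refine le_trans ?_ (I.prophet_succ_ge k)
    refine le_trans ?_ (mul_le_mul_right (add_le_add (pareto_integral_ge h0 h1.le k)
      (ih (by omega))) _)
    have hl1 : 0 < 1 - l := by linarith
    have e2 : I.surv = ENNReal.ofReal (1 - l) := rfl
    set A := Real.pi / 2 - Real.arctan √(m * l) with hA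
    have hA0 : 0 ≤ A := by have := Real.arctan_lt_pi_div_two √(m * l); linarith
    have hkm : (k + 1 : ℝ) ≤ m := by exact_mod_cast hk
    have hAk : A ≤ Real.pi / 2 - Real.arctan √((k + 1 : ℝ) * l) := by
      have : Real.arctan √((k + 1 : ℝ) * l) ≤ Real.arctan √(m * l) :=
        Real.arctan_mono (Real.sqrt_le_sqrt (by gcongr))
      linarith
    have hS := invSqrtSum_nonneg k
    rw [e2, ← ENNReal.ofReal_pow hl1.le, ← ENNReal.ofReal_add (by
      exact div_nonneg (hA0.trans hAk) (by positivity)) (by positivity),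
      ← ENNReal.ofReal_mul (by positivity)]
    refine ENNReal.ofReal_le_ofReal ?_
    have hp1 : (1 - l) ^ m ≤ (1 - l) ^ k := pow_le_pow_of_le_one hl1.le (by linarith) (by omega)
    have hp2 : ((1 - l) ^ m) ^ k ≤ 1 :=
      pow_le_one₀ (by positivity) (pow_le_one₀ hl1.le (by linarith))
    calc ((1 - l) ^ m) ^ (k + 1) * A * (invSqrtSum (k + 1) / √l)
        = (1 - l) ^ m * (((1 - l) ^ m) ^ k * (A / √((k + 1 : ℝ) * l)) +
          ((1 - l) ^ m) ^ k * A * (invSqrtSum k / √l)) := by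
          rw [invSqrtSum_succ, Real.sqrt_mul (by positivity)]
          field_simp
          ring
      _ ≤ (1 - l) ^ k * (1 * ((Real.pi / 2 - Real.arctan √((k + 1 : ℝ) * l)) / √((k + 1 : ℝ) * l)) +
          ((1 - l) ^ m) ^ k * A * (invSqrtSum k / √l)) := by gcongr
      _ = _ := by rw [one_mul]

lemma invSqrtSum_pos {m : ℕ} (hm : 1 ≤ m) : 0 < invSqrtSum m :=
  Finset.sum_pos (fun _ _ => by positivity) (Finset.nonempty_range_iff.2 (by omega))

/-- The prophet gets the best buyer between any two consecutive departures. For small departure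
rates this is `π / 2` times what an online policy gets. -/
theorem pi_div_two_le_competitiveRatio {m : ℕ} (hm : 1 ≤ m) (S : PricingScheme m) :
    ENNReal.ofReal (Real.pi / 2) ≤ S.competitiveRatio := by
  set f : ℝ → ℝ := fun l => ((1 - l) ^ m) ^ m * (Real.pi / 2 - Real.arctan √(m * l)) * √(1 - l)
    with hf
  have hcont : Continuous f := by
    have := Real.continuous_arctan
    fun_prop
  have hlim : Filter.Tendsto (fun l => ENNReal.ofReal (f l)) (nhdsWithin 0 (Set.Ioi 0))
      (nhds (ENNReal.ofReal (Real.pi / 2))) := by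
    refine ((ENNReal.continuous_ofReal.comp hcont).tendsto' 0 _ ?_).mono_left nhdsWithin_le_nhds
    simp [hf]
  refine le_of_tendsto hlim ?_
  filter_upwards [Ioo_mem_nhdsGT (zero_lt_one' ℝ)] with l hl
  have hl1 : 0 < 1 - l := by linarith [hl.2]
  have hl0 : 0 < l := hl.1
  have hS := invSqrtSum_pos hm
  refine S.le_competitiveRatio (paretoInstance l hl.1 hl.2.le)
    (v := ENNReal.ofReal (invSqrtSum m / √(l * (1 - l)))) ?_ ENNReal.ofReal_ne_top
    (pareto_value_le hl.1 hl.2 _) ?_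
  · rw [Ne, ENNReal.ofReal_eq_zero, not_le]; positivity
  · refine le_trans (le_of_eq ?_) (pareto_prophet_ge hl.1 hl.2 m m le_rfl)
    rw [← ENNReal.ofReal_mul' (by positivity)]
    congr 1
    rw [hf, Real.sqrt_mul hl0.le]
    field_simp

/-! ### Many items with Pareto valuations -/

lemma invSqrtSum_le (m : ℕ) : invSqrtSum m ≤ 2 * √m := by
  induction m with
  | zero => simp [invSqrtSum]
  | succ m ih =>
    rw [invSqrtSum_succ]
    push_cast
    have h0 : 0 < √(m + 1 : ℝ) := by positivity
    have h1 : (√(m + 1 : ℝ)) ^ 2 = m + 1 := Real.sq_sqrt (by positivity)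
    have h2 : (√(m : ℝ)) ^ 2 = m := Real.sq_sqrt (by positivity)
    have h3 : 1 / √(m + 1 : ℝ) ≤ 2 * √(m + 1 : ℝ) - 2 * √(m : ℝ) := by
      rw [div_le_iff₀ h0]
      nlinarith [sq_nonneg (√(m + 1 : ℝ) - √(m : ℝ))]
    linarith

/-- The prophet serves blocks of `n` buyers, where each item survives a block with probability
`r ^ 2`. In each block the threshold is such that the expected number of buyers above it is a
fraction `r` of the expected number of items that depart in the next block. -/
lemma pareto_prophet_ge_blocks {l r : ℝ} (h0 : 0 < l) (h1 : l < 1) (hr0 : 0 < r) (hr1 : r < 1)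
    {m n J : ℕ} (hm : 1 ≤ m) (hmn : m ≤ n) (hpow : (1 - l) ^ n = r ^ 2)
    (hJ : 20 ≤ (1 - r) ^ 3 * (m * r ^ (2 * J) * (1 - r ^ 2))) :
    ENNReal.ofReal (2 * r * √(n * (r * (m * (1 - r ^ 2)))) * (r * (1 - r ^ J) / (1 - r))) ≤
      (paretoInstance l h0 h1.le).prophet m := by
  set I := paretoInstance l h0 h1.le
  have hr2 : 0 < 1 - r ^ 2 := by nlinarith
  have hη : 0 < 1 - r := by linarith
  have hmpos : (0 : ℝ) < m := by exact_mod_cast hm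
  have hnpos : (0 : ℝ) < n := by exact_mod_cast (hm.trans hmn)
  set M : ℕ → ℝ := fun j => m * r ^ (2 * (j + 1)) * (1 - r ^ 2) with hM
  have hMpos : ∀ j, 0 < M j := fun j => by positivity
  set q : ℕ → ℝ := fun j => r * M j / n with hq
  have hqpos : ∀ j, 0 < q j := fun j => by have := hMpos j; positivity
  -- By `m ≤ n`, the thresholds lie in `[1, ∞)`, where the tail of the law is exactly `x ^ (-2)`.
  have hq1 : ∀ j, q j ≤ 1 := by
    intro j
    rw [hq, div_le_one hnpos]
    have h2 : r ^ (2 * (j + 1)) ≤ 1 := pow_le_one₀ hr0.le hr1.le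
    have h3 : (m : ℝ) ≤ n := by exact_mod_cast hmn
    have h4 : M j ≤ m := by
      calc M j ≤ m * 1 * 1 := by
            refine mul_le_mul (by gcongr) ?_ hr2.le (by positivity)
            nlinarith
        _ = m := by ring
    nlinarith [hMpos j]
  set x : ℕ → ℝ≥0 := fun j => Real.toNNReal ((√(q j))⁻¹) with hx
  have hxval : ∀ j, max (x j : ℝ) 1 = (√(q j))⁻¹ := by
    intro j
    have h2 : 1 ≤ (√(q j))⁻¹ := by
      rw [one_le_inv₀ (Real.sqrt_pos.2 (hqpos j))]
      exact (Real.sqrt_le_sqrt (hq1 j)).trans_eq Real.sqrt_one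
    rw [hx, Real.coe_toNNReal _ (by positivity), max_eq_left h2]
  have hxq : ∀ j, I.valuation.real {y | x j ≤ y} = q j := by
    intro j
    have e : I.valuation = paretoLaw := rfl
    rw [e, measureReal_def, paretoLaw_Ici, hxval, inv_pow, inv_inv, Real.sq_sqrt (hqpos j).le,
      ENNReal.toReal_ofReal (hqpos j).le]
  have hMJ : ∀ j < J, 20 ≤ (1 - r) ^ 3 * M j := by
    intro j hj
    refine hJ.trans ?_
    have : r ^ (2 * J) ≤ r ^ (2 * (j + 1)) := pow_le_pow_of_le_one hr0.le hr1.le (by omega)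
    simp only [hM]
    gcongr
  have hmain := prophet_ge_sum_blocks I m n J x hη M ?_ ?_ ?_
  rotate_left
  · intro j
    have e : (1 - I.rate : ℝ) = 1 - l := rfl
    rw [e, mul_comm (j + 1) n, mul_comm (j + 2) n, pow_mul, pow_mul, hpow, ← pow_mul, ← pow_mul]
    simp only [hM]; ring
  · intro j _
    rw [hxq]
    simp only [hq]
    rw [mul_div_cancel₀ _ hnpos.ne']
    linarith
  · intro j hj
    have h2 := hMJ j hj
    have h3 : (1 - r) ^ 3 * M j ≤ (1 - r) * M j := by
      have : (1 - r) ^ 3 ≤ (1 - r) ^ 1 := pow_le_pow_of_le_one hη.le (by linarith) (by omega)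
      rw [pow_one] at this
      have := hMpos j
      gcongr
    linarith
  refine le_trans ?_ hmain
  have hterm : ∀ j ∈ Finset.range J,
      ENNReal.ofReal (2 * r * √(n * (r * (m * (1 - r ^ 2)))) * r ^ (j + 1)) ≤
      n * (∫⁻ y in {y : ℝ≥0 | x j ≤ y}, (y : ℝ≥0∞) ∂I.valuation) *
      ENNReal.ofReal (1 - 20 / ((1 - r) ^ 2 * M j)) := by
    intro j hj
    have e : I.valuation = paretoLaw := rfl
    have hr' : r ≤ 1 - 20 / ((1 - r) ^ 2 * M j) := by
      have h2 := hMJ j (Finset.mem_range.1 hj)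
      have h3 := hMpos j
      have : 20 / ((1 - r) ^ 2 * M j) ≤ 1 - r := by
        rw [div_le_iff₀ (by positivity)]
        calc (20 : ℝ) ≤ _ := h2
          _ = _ := by ring
      linarith
    rw [e, setLIntegral_id_paretoLaw_Ici, hxval, ← ENNReal.ofReal_natCast,
      ← ENNReal.ofReal_mul (by positivity), ← ENNReal.ofReal_mul (by positivity)]
    refine ENNReal.ofReal_le_ofReal ?_
    have hsq : n * √(q j) = √(n * (r * (m * (1 - r ^ 2)))) * r ^ (j + 1) := by
      rw [← Real.sqrt_sq (show 0 ≤ r ^ (j + 1) by positivity), ← Real.sqrt_mul (by positivity)]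
      nth_rewrite 1 [← Real.sqrt_sq hnpos.le]
      rw [← Real.sqrt_mul (by positivity)]
      congr 1
      simp only [hq, hM]
      field_simp
      ring
    calc _ = n * (2 / (√(q j))⁻¹) * r := by
          rw [div_inv_eq_mul, mul_assoc (2 * r), ← hsq]; ring
      _ ≤ _ := by gcongr
  refine le_trans (le_of_eq ?_) (Finset.sum_le_sum hterm)
  rw [← ENNReal.ofReal_sum_of_nonneg fun _ _ => by positivity, ← Finset.mul_sum]
  congr 2
  simp_rw [pow_succ', ← Finset.mul_sum]
  rw [geom_sum_eq hr1.ne, mul_div_assoc, ← neg_div_neg_eq (r ^ J - 1)]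
  ring

/-- As the number of items grows, the gap on Pareto instances tends to `2`: the prophet gets
`4 √(m / rate)`, and an online policy gets `2 √(m / rate)`, up to lower order terms. -/
theorem eventually_le_competitiveRatio {c : ℝ} (hc : c < 2) :
    ∀ᶠ m : ℕ in Filter.atTop, ∀ S : PricingScheme m, ENNReal.ofReal c ≤ S.competitiveRatio := by
  -- The ratio will be at least `r ^ 4 * (1 + r)`, for `r` close to `1`.
  obtain ⟨r, hr0, hr1, hcr⟩ : ∃ r : ℝ, 0 < r ∧ r < 1 ∧ c ≤ r ^ 4 * (1 + r) := by
    have hlim : Filter.Tendsto (fun r : ℝ => r ^ 4 * (1 + r)) (nhdsWithin 1 (Set.Iio 1))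
        (nhds 2) := by
      refine (Continuous.tendsto' (by fun_prop) 1 2 (by norm_num)).mono_left nhdsWithin_le_nhds
    obtain ⟨r, h1, h2⟩ := ((hlim.eventually (lt_mem_nhds hc)).and
      (Ioo_mem_nhdsLT (zero_lt_one' ℝ))).exists
    exact ⟨r, h2.1, h2.2, le_of_lt h1⟩
  obtain ⟨J, hJ⟩ := exists_pow_lt_of_lt_one (show 0 < 1 - r by linarith) hr1
  have hr2 : 0 < 1 - r ^ 2 := by nlinarith
  have hη : 0 < 1 - r := by linarith
  have hK : 0 < (1 - r) ^ 3 * (r ^ (2 * J) * (1 - r ^ 2)) := by positivity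
  filter_upwards [Filter.eventually_ge_atTop 1, Filter.eventually_ge_atTop
    ⌈20 / ((1 - r) ^ 3 * (r ^ (2 * J) * (1 - r ^ 2)))⌉₊] with m hm hm2 S
  have hm2 := (div_le_iff₀ hK).1 ((Nat.le_ceil _).trans (Nat.cast_le.2 hm2))
  have hmpos : (0 : ℝ) < m := by exact_mod_cast hm
  -- The block length only has to be large; the departure rate is chosen accordingly.
  set n := m + 2 with hn
  have hnpos : (0 : ℝ) < n := by positivity
  set l : ℝ := 1 - r ^ (2 / n : ℝ) with hl
  have hrpow : r ^ (2 / n : ℝ) < 1 := Real.rpow_lt_one hr0.le hr1 (by positivity)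
  have hrpow0 : 0 < r ^ (2 / n : ℝ) := Real.rpow_pos_of_pos hr0 _
  have h0 : 0 < l := by linarith
  have h1 : l < 1 := by linarith
  have hpow : (1 - l) ^ n = r ^ 2 := by
    rw [hl, sub_sub_cancel, ← Real.rpow_natCast, ← Real.rpow_mul hr0.le,
      div_mul_cancel₀ _ hnpos.ne']
    norm_num
  have hlr : r ≤ 1 - l := by
    rw [hl, sub_sub_cancel]
    calc r = r ^ (1 : ℝ) := (Real.rpow_one r).symm
      _ ≤ _ := by
        refine Real.rpow_le_rpow_of_exponent_ge hr0 hr1.le ?_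
        rw [div_le_one hnpos, hn]
        push_cast; linarith
  have hnl : 1 - r ^ 2 ≤ n * l := by
    have := (paretoInstance l h0 h1.le).one_sub_rate_pow_ge n
    have e : ((paretoInstance l h0 h1.le).rate : ℝ) = l := rfl
    rw [e, hpow] at this
    linarith
  have hl1 : 0 < 1 - l := by linarith
  refine S.le_competitiveRatio (paretoInstance l h0 h1.le)
    (v := ENNReal.ofReal (2 * √m / √(l * (1 - l)))) ?_ ENNReal.ofReal_ne_top
    ((pareto_value_le h0 h1 _).trans (ENNReal.ofReal_le_ofReal ?_)) ?_
  · rw [Ne, ENNReal.ofReal_eq_zero, not_le]; positivity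
  · gcongr; exact invSqrtSum_le m
  · refine le_trans ?_ (pareto_prophet_ge_blocks h0 h1 hr0 hr1 hm (by omega : m ≤ n) hpow
      (J := J) ?_)
    · rw [← ENNReal.ofReal_mul' (by positivity)]
      refine ENNReal.ofReal_le_ofReal ?_
      have hden : 0 < √(l * (1 - l)) := by positivity
      rw [mul_div_assoc', div_le_iff₀ hden]
      have hsq : √m * (r * (1 - r ^ 2)) ≤ √(n * (r * (m * (1 - r ^ 2)))) * √(l * (1 - l)) := by
        rw [← Real.sqrt_mul (by positivity),
          ← Real.sqrt_sq (show 0 ≤ r * (1 - r ^ 2) by positivity), ← Real.sqrt_mul (by positivity)]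
        refine Real.sqrt_le_sqrt ?_
        calc (m : ℝ) * (r * (1 - r ^ 2)) ^ 2 = (1 - r ^ 2) * r * (r * (m * (1 - r ^ 2))) := by ring
          _ ≤ (n * l) * (1 - l) * (r * (m * (1 - r ^ 2))) := by gcongr
          _ = _ := by ring
      calc c * (2 * √m) ≤ r ^ 4 * (1 + r) * (2 * √m) := by gcongr
        _ = 2 * r * (√m * (r * (1 - r ^ 2))) * (r * r / (1 - r)) := by
          field_simp; ring
        _ ≤ 2 * r * (√(n * (r * (m * (1 - r ^ 2)))) * √(l * (1 - l))) *
            (r * (1 - r ^ J) / (1 - r)) := by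
          have : r ≤ 1 - r ^ J := by linarith
          gcongr
        _ = _ := by ring
    · calc (20 : ℝ) ≤ _ := hm2
        _ = _ := by ring

/-! ### Fixed prices -/

lemma hasSum_telescope {f : ℕ → ℝ} (hf : Antitone f)
    (hlim : Filter.Tendsto f Filter.atTop (nhds 0)) : HasSum (fun i => f i - f (i + 1)) (f 0) := by
  rw [hasSum_iff_tendsto_nat_of_nonneg fun i => sub_nonneg.2 (hf (Nat.le_succ i))]
  simp_rw [Finset.sum_range_sub']
  simpa using hlim.const_sub (f 0)

/-- The values of the hard instance for fixed prices. The value `i` has probability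
`2 ^ (-(i + 1))`, so that the values from `j` on contribute `1 / (j + 3)` to the mean. -/
noncomputable def hardValue (i : ℕ) : ℝ≥0 := 2 ^ (i + 1) / ((i + 3) * (i + 4))

lemma hardValue_strictMono : StrictMono hardValue := by
  refine strictMono_nat_of_lt_succ fun i => ?_
  rw [← NNReal.coe_lt_coe]
  simp only [hardValue]
  push_cast
  rw [div_lt_div_iff₀ (by positivity) (by positivity), pow_succ 2 (i + 1)]
  have : (0 : ℝ) < 2 ^ (i + 1) := by positivity
  nlinarith [mul_pos this (by positivity : (0 : ℝ) < (i + 4) * (i + 1))]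

/-- The valuation law of the hard instance for fixed prices. -/
noncomputable def hardLaw : Measure ℝ≥0 :=
  (geometricMeasure ⟨1 / 2, by norm_num, by norm_num⟩).map hardValue

instance : IsProbabilityMeasure hardLaw := Measure.isProbabilityMeasure_map (by fun_prop)

lemma half_geometric_singleton (i : ℕ) :
    geometricMeasure ⟨1 / 2, by norm_num, by norm_num⟩ {i} =
      ENNReal.ofReal ((1 / 2) ^ (i + 1)) := by
  rw [geometricMeasure_singleton (fun h => by simpa using congrArg Subtype.val h)]
  congr 1
  simp only [pow_succ]
  norm_num

lemma setLIntegral_hardLaw {S : Set ℝ≥0} (hS : MeasurableSet S) {j : ℕ}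
    (hSj : hardValue ⁻¹' S = Set.Ici j) {g : ℝ≥0 → ℝ≥0∞} (hg : Measurable g) :
    ∫⁻ y in S, g y ∂hardLaw =
      ∑' i : ℕ, g (hardValue (i + j)) * ENNReal.ofReal ((1 / 2) ^ (i + j + 1)) := by
  rw [hardLaw, setLIntegral_map hS hg (by fun_prop), hSj, ← lintegral_indicator measurableSet_Ici,
    lintegral_countable']
  simp_rw [half_geometric_singleton]
  rw [← (add_left_injective j).tsum_eq]
  · refine tsum_congr fun i => ?_
    simp
  · intro i hi
    by_contra hc
    have : ¬ j ≤ i := fun h => hc ⟨i - j, Nat.sub_add_cancel h⟩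
    simp [this] at hi

lemma hardLaw_apply {S : Set ℝ≥0} (hS : MeasurableSet S) {j : ℕ}
    (hSj : hardValue ⁻¹' S = Set.Ici j) : hardLaw S = ENNReal.ofReal ((1 / 2) ^ j) := by
  have h := setLIntegral_hardLaw hS hSj (g := fun _ => 1) measurable_const
  rw [setLIntegral_one] at h
  have hsum : HasSum (fun i : ℕ => (1 / 2 : ℝ) ^ (i + j) - (1 / 2) ^ (i + 1 + j))
      ((1 / 2) ^ (0 + j)) := hasSum_telescope (f := fun i => (1 / 2 : ℝ) ^ (i + j))
    (fun a b hab => pow_le_pow_of_le_one (by norm_num) (by norm_num) (by omega))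
    ((Filter.tendsto_add_atTop_iff_nat j).2
      (tendsto_pow_atTop_nhds_zero_of_lt_one (by norm_num) (by norm_num)))
  rw [zero_add] at hsum
  have hterm : ∀ i : ℕ, (1 / 2 : ℝ) ^ (i + j) - (1 / 2) ^ (i + 1 + j) = (1 / 2) ^ (i + j + 1) := by
    intro i
    rw [show i + 1 + j = i + j + 1 by ring, pow_succ]; ring
  simp_rw [hterm] at hsum
  rw [h, ← hsum.tsum_eq, ENNReal.ofReal_tsum_of_nonneg (fun _ => by positivity) hsum.summable]
  simp

lemma setLIntegral_id_hardLaw {S : Set ℝ≥0} (hS : MeasurableSet S) {j : ℕ}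
    (hSj : hardValue ⁻¹' S = Set.Ici j) :
    ∫⁻ y in S, (y : ℝ≥0∞) ∂hardLaw = ENNReal.ofReal (1 / (j + 3)) := by
  rw [setLIntegral_hardLaw hS hSj (by fun_prop)]
  have hsum : HasSum (fun i : ℕ => 1 / (((i + j : ℕ) : ℝ) + 3) - 1 / (((i + 1 + j : ℕ) : ℝ) + 3))
      (1 / (((0 + j : ℕ) : ℝ) + 3)) := by
    refine hasSum_telescope (f := fun i => 1 / (((i + j : ℕ) : ℝ) + 3)) (fun a b hab => ?_) ?_
    · have : ((a + j : ℕ) : ℝ) ≤ (b + j : ℕ) := by exact_mod_cast (by omega)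
      simp only
      gcongr
    · refine Filter.Tendsto.const_div_atTop (Filter.Tendsto.atTop_add ?_ tendsto_const_nhds) 1
      exact tendsto_natCast_atTop_atTop.comp (Filter.tendsto_add_atTop_nat j)
  rw [zero_add] at hsum
  rw [← hsum.tsum_eq, ENNReal.ofReal_tsum_of_nonneg _ hsum.summable]
  · refine tsum_congr fun i => ?_
    rw [← ENNReal.ofReal_coe_nnreal, ← ENNReal.ofReal_mul (by positivity)]
    congr 1
    simp only [hardValue]
    push_cast
    rw [div_pow, one_pow]
    field_simp
    ring
  · intro i
    rw [sub_nonneg]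
    push_cast
    gcongr
    linarith

/-- The instance with valuation law `hardLaw` and departure rate `l`. -/
noncomputable def hardInstance (l : ℝ) (h0 : 0 < l) (h1 : l ≤ 1) : GeometricInstance where
  rate := ⟨l, h0.le, h1⟩
  rate_ne_zero := fun h => h0.ne' (congrArg Subtype.val h)
  valuation := hardLaw
  valuation_prob := inferInstance
  finite_mean := by
    have h := setLIntegral_id_hardLaw (j := 0) MeasurableSet.univ (by ext; simp)
    rw [setLIntegral_univ] at h
    rw [h]; exact ENNReal.ofReal_ne_top

/-- Any price accepts either no value or all values from some index on. -/
lemma hardValue_preimage (p : ℝ≥0∞) :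
    hardValue ⁻¹' {y | p ≤ y} = ∅ ∨ ∃ j, hardValue ⁻¹' {y | p ≤ y} = Set.Ici j := by
  classical
  by_cases h : ∃ i, p ≤ hardValue i
  · refine Or.inr ⟨Nat.find h, ?_⟩
    ext i
    simp only [Set.mem_preimage, Set.mem_ofPred_eq, Set.mem_Ici]
    refine ⟨fun hi => Nat.find_min' h hi, fun hi => (Nat.find_spec h).trans ?_⟩
    exact_mod_cast hardValue_strictMono.monotone hi
  · push Not at h
    refine Or.inl (Set.eq_empty_of_forall_notMem fun i hi => absurd hi (not_le.2 (h i)))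

lemma one_div_le_log_sub_log {y : ℝ} (hy : 0 < y) :
    1 / (y + 1) ≤ Real.log (y + 1) - Real.log y := by
  rw [← Real.log_div (by positivity) hy.ne']
  have h := Real.one_sub_inv_le_log_of_pos (show 0 < (y + 1) / y by positivity)
  refine le_trans (le_of_eq ?_) h
  field_simp
  ring

lemma sum_one_div_le_log (m : ℕ) {y : ℝ} (hy : 0 < y) :
    ∑ k ∈ Finset.range m, 1 / (k + 1 + y) ≤ Real.log (m + y) - Real.log y := by
  induction m with
  | zero => simp
  | succ m ih =>
    rw [Finset.sum_range_succ]
    have := one_div_le_log_sub_log (show 0 < m + y by positivity)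
    push_cast
    rw [show (m : ℝ) + 1 + y = m + y + 1 by ring]
    linarith

lemma log_le_sum_one_div (J : ℕ) {y : ℝ} (hy : 0 < y) :
    Real.log (J + y) - Real.log y ≤ ∑ j ∈ Finset.range J, 1 / (j + y) := by
  induction J with
  | zero => simp
  | succ J ih =>
    rw [Finset.sum_range_succ]
    have hJ : 0 < J + y := by positivity
    have h := Real.log_le_sub_one_of_pos (show 0 < (J + y + 1) / (J + y) by positivity)
    rw [Real.log_div (by positivity) hJ.ne'] at h
    have e : (J + y + 1) / (J + y) - 1 = 1 / (J + y) := by field_simp; ring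
    push_cast
    rw [show (J : ℝ) + 1 + y = J + y + 1 by ring]
    linarith

/-- A fixed price that accepts the values from `j` on sells out within `O(m (j + 1))` buyers in
expectation, each of whom contributes `1 / (j + 3)`. -/
lemma hard_value_le {l : ℝ} (h0 : 0 < l) (h1 : l ≤ 1) {m : ℕ} (hm : 1 ≤ m)
    (hpow : (1 - l) ^ m = 1 / 2) {P : PricingPolicy m} (hP : P.IsFixedPrice) :
    P.value (hardInstance l h0 h1) ≤ ENNReal.ofReal (2 * m) := by
  obtain ⟨p, hp⟩ := hP
  set I := hardInstance l h0 h1 with hI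
  have hmpos : (0 : ℝ) < m := by exact_mod_cast hm
  have hml : 1 / 2 ≤ m * l := by
    have := I.one_sub_rate_pow_ge m
    have e : (I.rate : ℝ) = l := rfl
    rw [e, hpow] at this
    linarith
  have hl : 1 / 2 ≤ 1 - l := by
    rw [← hpow]
    have := pow_le_pow_of_le_one (show 0 ≤ 1 - l by linarith) (by linarith) hm
    rwa [pow_one] at this
  refine P.value_le I fun r => ?_
  have hpm : MeasurableSet {y : ℝ≥0 | p r ≤ y} := measurableSet_le measurable_const (by fun_prop)
  have e1 : I.dep = ENNReal.ofReal l := rfl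
  have e2 : I.surv = ENNReal.ofReal (1 - l) := rfl
  have e3 : I.valuation = hardLaw := rfl
  rcases hardValue_preimage (p r) with hj | ⟨j, hj⟩
  · refine le_trans (P.lintegral_welfare_le I r (δ := fun _ => 0) (fun _ _ _ => le_rfl)
      fun k _ t past obs A => ?_) (by simp)
    rw [hp, e3]
    have : hardLaw {y : ℝ≥0 | p r ≤ y} = 0 := by
      rw [hardLaw, Measure.map_apply (by fun_prop) hpm, hj, measure_empty]
    rw [setLIntegral_measure_zero _ _ this]
    exact zero_le
  -- The potential is chosen so that the bound of the potential argument is an equality.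
  · set q : ℝ := (1 / 2) ^ j with hq
    have hq0 : 0 < q := by positivity
    set D : ℕ → ℝ := fun k => (k + 1) * l + (1 - l) * q with hD
    have hD0 : ∀ k, 0 < D k := fun k => by positivity
    refine le_trans (P.lintegral_welfare_le I r (δ := fun k => ENNReal.ofReal (1 / (j + 3) / D k))
      (fun a b hab => ENNReal.ofReal_le_ofReal ?_) fun k _ t past obs A => ?_) ?_
    · have : (a : ℝ) ≤ b := by exact_mod_cast hab
      refine div_le_div_of_nonneg_left (by positivity) (hD0 a) ?_
      simp only [hD]
      gcongr
    · rw [hp, e1, e2, e3, setLIntegral_id_hardLaw hpm hj, hardLaw_apply hpm hj,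
        ← ENNReal.ofReal_natCast, ← ENNReal.ofReal_mul (by positivity),
        ← ENNReal.ofReal_mul (by linarith), ← ENNReal.ofReal_add (by positivity) (by positivity),
        ← ENNReal.ofReal_mul (by positivity)]
      refine ENNReal.ofReal_le_ofReal (le_of_eq ?_)
      push_cast
      exact (mul_div_cancel₀ _ (hD0 k).ne').symm
    · rw [← ENNReal.ofReal_sum_of_nonneg fun k _ => by have := hD0 k; positivity]
      refine ENNReal.ofReal_le_ofReal ?_
      have hterm : ∀ k ∈ Finset.range m,
          1 / (j + 3) / D k ≤ 2 * m / (j + 3) * (1 / (k + 1 + m * q)) := by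
        intro k _
        have h2 : (k + 1 + m * q) ≤ 2 * m * D k := by
          simp only [hD]
          have h3 : (k + 1 : ℝ) * (1 / 2) ≤ (k + 1) * (m * l) := by gcongr
          have h4 : m * q * (1 / 2) ≤ m * q * (1 - l) := by gcongr
          nlinarith
        rw [div_div, div_mul_div_comm, mul_one, div_le_div_iff₀ (mul_pos (by positivity) (hD0 k))
          (by positivity), one_mul]
        calc (j + 3 : ℝ) * (k + 1 + m * q) ≤ (j + 3) * (2 * m * D k) := by gcongr
          _ = _ := by ring
      refine (Finset.sum_le_sum hterm).trans ?_
      rw [← Finset.mul_sum]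
      have hlog := sum_one_div_le_log m (show 0 < m * q by positivity)
      have h5 : Real.log (m + m * q) - Real.log (m * q) ≤ j + 1 := by
        rw [← Real.log_div (by positivity) (by positivity)]
        have h6 : (m + m * q) / (m * q) = 1 + 2 ^ j := by
          rw [hq, div_pow, one_pow]
          field_simp
          ring
        rw [h6]
        calc Real.log (1 + 2 ^ j) ≤ Real.log (2 ^ (j + 1)) := by
              refine Real.log_le_log (by positivity) ?_
              have : (1 : ℝ) ≤ 2 ^ j := one_le_pow₀ (by norm_num)
              rw [pow_succ]; linarith
          _ = (j + 1) * Real.log 2 := by rw [Real.log_pow]; push_cast; ring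
          _ ≤ (j + 1) * 1 := by
              have := Real.log_two_lt_d9
              gcongr
              linarith
          _ = _ := mul_one _
      calc _ ≤ 2 * m / (j + 3 : ℝ) * (j + 3) := by
            gcongr
            linarith
        _ = _ := by field_simp

lemma hard_prophet_ge {l : ℝ} (h0 : 0 < l) (h1 : l ≤ 1) {m J : ℕ}
    (hpow : (1 - l) ^ m = 1 / 2) (hJ : 320 * 2 ^ J ≤ m) :
    ENNReal.ofReal (m / 2 * ∑ j ∈ Finset.range J, 1 / (j + 6 : ℝ)) ≤
      (hardInstance l h0 h1).prophet m := by
  set I := hardInstance l h0 h1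
  have e3 : I.valuation = hardLaw := rfl
  set M : ℕ → ℝ := fun j => m * (1 / 2) ^ (j + 2) with hM
  have hMJ : ∀ j < J, 160 ≤ M j := by
    intro j hj
    have h2 : (320 : ℝ) * 2 ^ (j + 1) ≤ m := by
      calc (320 : ℝ) * 2 ^ (j + 1) ≤ 320 * 2 ^ J := by gcongr <;> [norm_num; omega]
        _ ≤ m := by exact_mod_cast hJ
    simp only [hM]
    rw [div_pow, one_pow, mul_one_div, le_div_iff₀ (by positivity), pow_succ]
    linarith
  have hpre : ∀ j, hardValue ⁻¹' {y | hardValue j ≤ y} = Set.Ici j := by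
    intro j; ext i; simp [hardValue_strictMono.le_iff_le]
  have hmain := prophet_ge_sum_blocks I m m J (fun j => hardValue (j + 3)) (η := 1 / 2)
    (by norm_num) M ?_ ?_ ?_
  rotate_left
  · intro j
    have e : (1 - I.rate : ℝ) = 1 - l := rfl
    rw [e, mul_comm (j + 1), mul_comm (j + 2), pow_mul, pow_mul, hpow]
    simp only [hM]; ring
  · intro j _
    rw [e3, measureReal_def, hardLaw_apply (measurableSet_Ici_nnreal _) (hpre _),
      ENNReal.toReal_ofReal (by positivity)]
    simp only [hM]
    refine le_of_eq ?_
    ring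
  · intro j hj
    linarith [hMJ j hj]
  refine le_trans ?_ hmain
  rw [Finset.mul_sum, ENNReal.ofReal_sum_of_nonneg fun _ _ => by positivity]
  refine Finset.sum_le_sum fun j hj => ?_
  rw [e3, setLIntegral_id_hardLaw (measurableSet_Ici_nnreal _) (hpre _), ← ENNReal.ofReal_natCast,
    ← ENNReal.ofReal_mul (by positivity), ← ENNReal.ofReal_mul (by positivity)]
  refine ENNReal.ofReal_le_ofReal ?_
  have h2 := hMJ j (Finset.mem_range.1 hj)
  have h3 : (1 : ℝ) / 2 ≤ 1 - 20 / ((1 / 2) ^ 2 * M j) := by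
    have : 20 / ((1 / 2 : ℝ) ^ 2 * M j) ≤ 1 / 2 := by
      rw [div_le_iff₀ (by positivity)]; linarith
    linarith
  push_cast
  calc (m / 2 * (1 / (j + 6)) : ℝ) = m * (1 / (j + 3 + 3)) * (1 / 2) := by
        rw [show (j : ℝ) + 3 + 3 = j + 6 by ring]; ring
    _ ≤ _ := by gcongr

/-- Each of the `log m` scales of the valuations contributes to the prophet the harmonic share
`1 / (j + 3)`, while a fixed price only captures a single scale. -/
theorem fixedPrice_eventually_le_competitiveRatio :
    ∃ c : ℝ, 0 < c ∧ ∀ᶠ m : ℕ in Filter.atTop, ∀ S : PricingScheme m, S.IsFixedPrice →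
      ENNReal.ofReal (c * Real.log (Real.log m)) ≤ S.competitiveRatio := by
  refine ⟨1 / 8, by norm_num, ?_⟩
  have hlim : Filter.Tendsto (fun m : ℕ => Real.log (Real.log m)) Filter.atTop Filter.atTop :=
    Real.tendsto_log_atTop.comp (Real.tendsto_log_atTop.comp tendsto_natCast_atTop_atTop)
  filter_upwards [Filter.eventually_ge_atTop 320, hlim.eventually_ge_atTop 6] with m hm hll S hS
  have hm1 : 1 ≤ m := by omega
  have hmpos : (0 : ℝ) < m := by exact_mod_cast hm1
  -- The departure rate such that half of the items survive `m` buyers.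
  set l : ℝ := 1 - (1 / 2) ^ (1 / m : ℝ) with hl
  have hrpow : (1 / 2 : ℝ) ^ (1 / m : ℝ) < 1 :=
    Real.rpow_lt_one (by norm_num) (by norm_num) (by positivity)
  have hrpow0 : 0 < (1 / 2 : ℝ) ^ (1 / m : ℝ) := Real.rpow_pos_of_pos (by norm_num) _
  have h0 : 0 < l := by linarith
  have h1 : l ≤ 1 := by linarith
  have hpow : (1 - l) ^ m = 1 / 2 := by
    rw [hl, sub_sub_cancel, ← Real.rpow_natCast, ← Real.rpow_mul (by norm_num),
      div_mul_cancel₀ _ hmpos.ne', Real.rpow_one]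
  set J := Nat.log 2 (m / 320) with hJ
  have hdiv : m / 320 ≠ 0 := by omega
  have hJm : 320 * 2 ^ J ≤ m := by
    have := Nat.pow_log_le_self 2 hdiv
    rw [← hJ] at this
    omega
  have hJm2 : m < 320 * 2 ^ (J + 1) := by
    have := Nat.lt_pow_succ_log_self (b := 2) (by norm_num) (m / 320)
    rw [← hJ] at this
    have := Nat.succ_le_of_lt this
    omega
  have hlogm : Real.log m ≤ J + 10 := by
    have h2 : (m : ℝ) ≤ 2 ^ (J + 10) := by
      have h3 : m ≤ 2 ^ (J + 10) := by
        rw [pow_succ] at hJm2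
        rw [pow_add]; omega
      exact_mod_cast h3
    calc Real.log m ≤ Real.log (2 ^ (J + 10)) := Real.log_le_log hmpos h2
      _ = (J + 10) * Real.log 2 := by rw [Real.log_pow]; push_cast; ring
      _ ≤ (J + 10) * 1 := by
        have := Real.log_two_lt_d9
        gcongr
        linarith
      _ = _ := mul_one _
  have hlogpos : 0 < Real.log m := by
    refine Real.log_pos ?_
    exact_mod_cast (by omega : 1 < m)
  have hsum : Real.log (Real.log m) / 2 ≤ ∑ j ∈ Finset.range J, 1 / (j + 6 : ℝ) := by
    have h2 := log_le_sum_one_div J (show (0 : ℝ) < 6 by norm_num)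
    have h3 : Real.log (Real.log m) ≤ Real.log (2 * (J + 6)) :=
      Real.log_le_log hlogpos (by linarith [(Nat.cast_nonneg J : (0 : ℝ) ≤ J)])
    rw [Real.log_mul (by norm_num) (by positivity)] at h3
    have h4 : Real.log 2 + Real.log 6 ≤ 3 := by
      rw [← Real.log_mul (by norm_num) (by norm_num)]
      calc Real.log (2 * 6) ≤ Real.log (2 ^ 4) := Real.log_le_log (by norm_num) (by norm_num)
        _ = 4 * Real.log 2 := by rw [Real.log_pow]; norm_num
        _ ≤ 3 := by linarith [Real.log_two_lt_d9]
    linarith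
  refine S.le_competitiveRatio (hardInstance l h0 h1) (v := ENNReal.ofReal (2 * m)) ?_
    ENNReal.ofReal_ne_top (hard_value_le h0 h1 hm1 hpow (hS _)) ?_
  · rw [Ne, ENNReal.ofReal_eq_zero, not_le]; positivity
  · refine le_trans ?_ (hard_prophet_ge h0 h1 hpow hJm)
    rw [← ENNReal.ofReal_mul' (by positivity)]
    refine ENNReal.ofReal_le_ofReal ?_
    have : m * (Real.log (Real.log m) / 2) ≤ m * ∑ j ∈ Finset.range J, 1 / (j + 6 : ℝ) := by gcongr
    linarith

end Prophet

theorem theorem3 :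
    (∀ m : ℕ, 1 ≤ m → ∀ S : Prophet.PricingScheme m,
      ENNReal.ofReal (Real.pi / 2) ≤ S.competitiveRatio) ∧
    (∀ c : ℝ, c < 2 → ∀ᶠ m : ℕ in Filter.atTop, ∀ S : Prophet.PricingScheme m,
      ENNReal.ofReal c ≤ S.competitiveRatio) ∧
    (∃ c : ℝ, 0 < c ∧ ∀ᶠ m : ℕ in Filter.atTop, ∀ S : Prophet.PricingScheme m,
      S.IsFixedPrice → ENNReal.ofReal (c * Real.log (Real.log m)) ≤ S.competitiveRatio) := by
  exact ⟨fun _ hm S => Prophet.pi_div_two_le_competitiveRatio hm S,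
    fun _ hc => Prophet.eventually_le_competitiveRatio hc,
    Prophet.fixedPrice_eventually_le_competitiveRatio⟩
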